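/- For a finite positive Borel measure $\mu$ on $\mathbb C$ with $\int\log(1+|x|)\,d\mu(x)<\infty$ let $V^\mu(z)=\int\log\frac1{|z-x|}\,d\mu(x)\in(-\infty,+\infty]$ be its logarithmic potential and $\mathcal E(\mu)=\int V^\mu\,d\mu\in(-\infty,+\infty]$ its logarithmic energy; let $\mathcal M$ be the set of all such $\mu$ with $\mathcal E(\mu)<+\infty$. Let $K\subset\mathbb C$ be a compact set with finitely many connected components, at least one of which is not a single point, and let $\varphi$ be a real-valued function on $K$ that is continuous on $K\setminus e$ for some finite set $e$ (no restriction is placed on the behavior of $\varphi$ near the points of $e$). Let $\mathcal M(K,\varphi)$ be the set of all $\mu\in\mathcal M$ with $\mu(\mathbb C)=1$, $\operatorname{supp}\mu\subset K$ and $\varphi\in L^1(\mu)$, and put $$\mathcal E_\varphi(\mu)=\mathcal E(\mu)+2\int\varphi\,d\mu,\qquad \mathcal E_\varphi[K]=\inf_{\mu\in\mathcal M(K,\varphi)}\mathcal E_\varphi(\mu).$$ Theorem. If $\mathcal E_\varphi[K]>-\infty$, then there exists a unique measure $\lambda\in\mathcal M(K,\varphi)$ with $\mathcal E_\varphi(\lambda)=\mathcal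 E_\varphi[K]$. -/

import Mathlib

open MeasureTheory

noncomputable section

namespace LogEnergy

/-- The integral of an extended-real function with respect to `μ`: the integral of the positive
part minus the integral of the negative part. -/
def eintegral (μ : Measure ℂ) (f : ℂ → EReal) : EReal :=
  ((∫⁻ x, (f x).toENNReal ∂μ : ENNReal) : EReal) - ((∫⁻ x, (-f x).toENNReal ∂μ : ENNReal) : EReal)

/-- The logarithmic kernel `log (1 / |z - x|)`, with value `+∞` for `z = x`. -/
def logKernel (z x : ℂ) : EReal := -ENNReal.log ‖z - x‖ₑ

/-- The logarithmic potential `V^μ(z) = ∫ log (1 / |z - x|) dμ(x)`. -/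
def potential (μ : Measure ℂ) (z : ℂ) : EReal := eintegral μ fun x => logKernel z x

/-- The logarithmic energy `ℰ(μ) = ∫ V^μ dμ`. -/
def energy (μ : Measure ℂ) : EReal := eintegral μ (potential μ)

/-- The class `ℳ`: finite positive Borel measures with `∫ log (1 + |x|) dμ(x) < ∞` and with
`ℰ(μ) < +∞`. -/
def finiteEnergyMeasures : Set (Measure ℂ) :=
  {μ | IsFiniteMeasure μ ∧ ∫⁻ x, ENNReal.ofReal (Real.log (1 + ‖x‖)) ∂μ < ⊤ ∧ energy μ < ⊤}

/-- The class `𝒦`: compact sets in the plane with finitely many connected components, at least one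
of which is not a single point. -/
structure IsAdmissibleCompact (K : Set ℂ) : Prop where
  isCompact : IsCompact K
  finite_components : Finite (ConnectedComponents K)
  exists_nontrivial_component : ∃ x ∈ K, (connectedComponentIn K x).Nontrivial

/-- The class `C*(K)`: real functions that are continuous on `K` except for a finite set of points.
Only the values of `φ` on `K` matter. -/
def IsExternalField (K : Set ℂ) (φ : ℂ → ℝ) : Prop :=
  ∃ e : Set ℂ, e.Finite ∧ ContinuousOn φ (K \ e)

/-- The class `ℳ(K, φ)`: unit measures `μ ∈ ℳ` with `φ ∈ L¹(μ)` and support in `K`. -/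
def admissibleMeasures (K : Set ℂ) (φ : ℂ → ℝ) : Set (Measure ℂ) :=
  {μ | μ ∈ finiteEnergyMeasures ∧ Integrable φ μ ∧ μ Set.univ = 1 ∧ μ.support ⊆ K}

/-- The total energy `ℰ_φ(μ) = ℰ(μ) + 2 ∫ φ dμ`. -/
def weightedEnergy (φ : ℂ → ℝ) (μ : Measure ℂ) : EReal :=
  energy μ + ((2 * ∫ x, φ x ∂μ : ℝ) : EReal)

/-- The equilibrium energy `ℰ_φ[K]`, the infimum of `ℰ_φ(μ)` over `μ ∈ ℳ(K, φ)`. -/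
def equilibriumEnergy (φ : ℂ → ℝ) (K : Set ℂ) : EReal :=
  ⨅ μ ∈ admissibleMeasures K φ, weightedEnergy φ μ

end LogEnergy

end

noncomputable section

namespace LogEnergy

open Filter Topology ENNReal Set
open scoped ComplexConjugate BoundedContinuousFunction

/-! On a set of diameter at most D, where D ≥ 1, the logarithmic kernel is the nonnegative kernel
`kern D` minus the constant log D. For probability measures on K one therefore minimizes I(μ) + 2∫φ
dμ, with I(μ) the nonnegative quantity `mutualEnergy D μ μ`.

Uniqueness is strict convexity (`exists_two_mul_mutualEnergy_add_le`). Gaussian kernels are strictly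
positive definite, because their energies are weighted L² products of characteristic functions. The
function log(1 + A/s²) is a mixture of Gaussians in s, and it differs from 2 log(D/s) by a constant
and an error that vanishes as A → ∞. Constants cancel for measures of equal mass.

Existence is the direct method: minimizing measures converge weakly, and I is lower semicontinuous.
The danger is that φ is very negative near e and that mass drifts there; finiteness of the infimum
excludes this. The lower bound first extends to all measures of mass at most one
(`exists_lower_bound`): the missing mass is supplied by a measure of bounded potential, which exists
because a nondegenerate component projects onto an interval of a coordinate axis. If arbitrarily
small masses arbitrarily near e had total energy below a fixed -c, many of them could be added up,
each much closer to e and much lighter than the previous ones, so that they hardly interact, and the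
bound would fail (`exists_thickening_le_totalEnergy`). Scaling a measure by t acts quadratically on
I and linearly on the field term; this turns the last fact into uniform smallness of the negative
part of the field near e (`exists_thickening_setIntegral_neg_ge`). With it the field term passes to
the weak limit with the inequality in the right direction (`exists_totalEnergy_le`). -/

/-! ### The nonnegative kernel and its mutual energies -/

/-- The positive part of the logarithmic kernel `log (D / |z - w|)`, with value `∞` for `z = w`. -/
def kern (D : ℝ) (z w : ℂ) : ℝ≥0∞ := (ENNReal.log (ENNReal.ofReal D / ‖z - w‖ₑ)).toENNReal

/-- The mutual energy of two measures for the kernel `kern D`. -/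
def mutualEnergy (D : ℝ) (μ ν : Measure ℂ) : ℝ≥0∞ := ∫⁻ z, ∫⁻ w, kern D z w ∂ν ∂μ

lemma continuous_kern {D : ℝ} (hD : 0 < D) : Continuous fun p : ℂ × ℂ => kern D p.1 p.2 := by
  have h : Continuous fun p : ℂ × ℂ => ENNReal.ofReal D / ‖p.1 - p.2‖ₑ := by
    have h1 : Continuous fun p : ℂ × ℂ => ‖p.1 - p.2‖ₑ := by fun_prop
    rw [continuous_iff_continuousAt]
    intro p
    exact ENNReal.Tendsto.div tendsto_const_nhds (Or.inl (by simpa using hD))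
      (h1.tendsto p) (Or.inl enorm_ne_top)
  have h2 : Continuous fun p : ℂ × ℂ => ENNReal.log (ENNReal.ofReal D / ‖p.1 - p.2‖ₑ) :=
    ENNReal.continuous_log.comp h
  exact EReal.continuous_toENNReal.comp h2

lemma measurable_kern {D : ℝ} (hD : 0 < D) : Measurable fun p : ℂ × ℂ => kern D p.1 p.2 :=
  (continuous_kern hD).measurable

lemma measurable_kern_right {D : ℝ} (hD : 0 < D) (z : ℂ) : Measurable fun w => kern D z w :=
  Measurable.of_uncurry_left (f := fun z w => kern D z w) (measurable_kern hD)

lemma measurable_lintegral_kern {D : ℝ} (hD : 0 < D) (ν : Measure ℂ) [SFinite ν] :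
    Measurable fun z => ∫⁻ w, kern D z w ∂ν :=
  (measurable_kern hD).lintegral_prod_right'

lemma kern_comm (D : ℝ) (z w : ℂ) : kern D z w = kern D w z := by
  simp only [kern, enorm_sub_rev]

lemma kern_of_ne {D : ℝ} (hD : 0 < D) {z w : ℂ} (h : z ≠ w) :
    kern D z w = ENNReal.ofReal (Real.log (D / ‖z - w‖)) := by
  have h' : 0 < ‖z - w‖ := norm_pos_iff.2 (sub_ne_zero.2 h)
  rw [kern, ← ofReal_norm, ← ENNReal.ofReal_div_of_pos h',
    ENNReal.log_ofReal_of_pos (div_pos hD h'), EReal.real_coe_toENNReal]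

lemma kern_self {D : ℝ} (hD : 0 < D) (z : ℂ) : kern D z z = ⊤ := by
  simp [kern, ENNReal.div_zero, hD]

lemma kern_le {D r : ℝ} (hD : 0 < D) (hr : 0 < r) {z w : ℂ} (h : r ≤ ‖z - w‖) :
    kern D z w ≤ ENNReal.ofReal (Real.log (D / r)) := by
  have h' : 0 < ‖z - w‖ := hr.trans_le h
  rw [kern_of_ne hD (sub_ne_zero.1 (norm_pos_iff.1 h'))]
  gcongr

lemma le_kern {D r : ℝ} (hD : 0 < D) {z w : ℂ} (h : ‖z - w‖ ≤ r) :
    ENNReal.ofReal (Real.log (D / r)) ≤ kern D z w := by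
  by_cases hzw : z = w
  · simp [hzw, kern_self hD]
  · have h' : 0 < ‖z - w‖ := norm_pos_iff.2 (sub_ne_zero.2 hzw)
    rw [kern_of_ne hD hzw]
    have : 0 < r := h'.trans_le h
    gcongr

lemma mutualEnergy_comm {D : ℝ} (hD : 0 < D) (μ ν : Measure ℂ) [SFinite μ] [SFinite ν] :
    mutualEnergy D μ ν = mutualEnergy D ν μ := by
  rw [mutualEnergy, lintegral_lintegral_swap (measurable_kern hD).aemeasurable]
  simp only [mutualEnergy, kern_comm D]

lemma mutualEnergy_add_left (D : ℝ) (μ μ' ν : Measure ℂ) :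
    mutualEnergy D (μ + μ') ν = mutualEnergy D μ ν + mutualEnergy D μ' ν := by
  simp [mutualEnergy, lintegral_add_measure]

lemma mutualEnergy_add_right {D : ℝ} (hD : 0 < D) (μ ν ν' : Measure ℂ) [SFinite ν] :
    mutualEnergy D μ (ν + ν') = mutualEnergy D μ ν + mutualEnergy D μ ν' := by
  simp only [mutualEnergy, lintegral_add_measure]
  exact lintegral_add_left (measurable_lintegral_kern hD ν) _

lemma mutualEnergy_smul_left (D : ℝ) (c : ℝ≥0∞) (μ ν : Measure ℂ) :
    mutualEnergy D (c • μ) ν = c * mutualEnergy D μ ν := by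
  simp [mutualEnergy]

lemma mutualEnergy_smul_right {D : ℝ} (hD : 0 < D) (c : ℝ≥0∞) (μ ν : Measure ℂ) [SFinite ν] :
    mutualEnergy D μ (c • ν) = c * mutualEnergy D μ ν := by
  simp only [mutualEnergy, lintegral_smul_measure, smul_eq_mul]
  exact lintegral_const_mul _ (measurable_lintegral_kern hD ν)

lemma mutualEnergy_mono (D : ℝ) {μ μ' ν ν' : Measure ℂ} (h : μ ≤ μ') (h' : ν ≤ ν') :
    mutualEnergy D μ ν ≤ mutualEnergy D μ' ν' :=
  lintegral_mono' h fun _ => lintegral_mono' h' le_rfl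

lemma mutualEnergy_eq_lintegral_prod {D : ℝ} (hD : 0 < D) (μ ν : Measure ℂ) [SFinite ν] :
    mutualEnergy D μ ν = ∫⁻ p, kern D p.1 p.2 ∂(μ.prod ν) :=
  (lintegral_prod _ (measurable_kern hD).aemeasurable).symm

lemma mutualEnergy_zero_left (D : ℝ) (ν : Measure ℂ) : mutualEnergy D 0 ν = 0 := by
  simp [mutualEnergy]

lemma mutualEnergy_add_self {D : ℝ} (hD : 0 < D) (μ ν : Measure ℂ) [SFinite μ] [SFinite ν] :
    mutualEnergy D (μ + ν) (μ + ν) =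
      mutualEnergy D μ μ + mutualEnergy D ν ν + 2 * mutualEnergy D μ ν := by
  rw [mutualEnergy_add_left, mutualEnergy_add_right hD, mutualEnergy_add_right hD,
    mutualEnergy_comm hD ν μ]
  ring

lemma mutualEnergy_le_of_potential_le {D : ℝ} {μ ν : Measure ℂ} {B : ℝ≥0∞}
    (h : ∀ z, ∫⁻ w, kern D z w ∂ν ≤ B) : mutualEnergy D μ ν ≤ B * μ univ := by
  calc mutualEnergy D μ ν ≤ ∫⁻ _, B ∂μ := lintegral_mono h
    _ = B * μ univ := by simp

lemma mutualEnergy_le_of_separated {D r : ℝ} (hD : 0 < D) (hr : 0 < r) {μ ν : Measure ℂ}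
    {S T : Set ℂ}
    (hS : μ Sᶜ = 0) (hT : ν Tᶜ = 0) (hST : ∀ z ∈ S, ∀ w ∈ T, r ≤ ‖z - w‖) :
    mutualEnergy D μ ν ≤ ENNReal.ofReal (Real.log (D / r)) * ν univ * μ univ := by
  calc mutualEnergy D μ ν ≤ ∫⁻ _, ENNReal.ofReal (Real.log (D / r)) * ν univ ∂μ := by
        refine lintegral_mono_ae ?_
        filter_upwards [(measure_eq_zero_iff_ae_notMem.1 hS)] with z hz
        calc ∫⁻ w, kern D z w ∂ν ≤ ∫⁻ _, ENNReal.ofReal (Real.log (D / r)) ∂ν := by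
              refine lintegral_mono_ae ?_
              filter_upwards [(measure_eq_zero_iff_ae_notMem.1 hT)] with w hw
              exact kern_le hD hr (hST z (not_not.1 hz) w (not_not.1 hw))
          _ = _ := by simp
    _ = _ := by simp

/-- A measure of finite energy charges small discs only a little. -/
lemma log_mul_measure_ball_sq_le {D r : ℝ} (hD : 0 < D) (μ : Measure ℂ) (p : ℂ) :
    ENNReal.ofReal (Real.log (D / (2 * r))) * μ (Metric.ball p r) ^ 2 ≤ mutualEnergy D μ μ := by
  set B := Metric.ball p r
  calc _ = ∫⁻ _ in B, ∫⁻ _ in B, ENNReal.ofReal (Real.log (D / (2 * r))) ∂μ ∂μ := by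
        simp [pow_two, mul_assoc]
    _ ≤ ∫⁻ z in B, ∫⁻ w in B, kern D z w ∂μ ∂μ := by
        refine setLIntegral_mono' Metric.isOpen_ball.measurableSet fun z hz => ?_
        refine setLIntegral_mono' Metric.isOpen_ball.measurableSet fun w hw => ?_
        refine le_kern hD ?_
        rw [← dist_eq_norm]
        have := dist_triangle_right z w p
        have h1 := Metric.mem_ball.1 hz
        have h2 := Metric.mem_ball.1 hw
        linarith
    _ ≤ mutualEnergy D μ μ := mutualEnergy_mono D Measure.restrict_le_self Measure.restrict_le_self

/-- An atom would contribute its squared mass times the infinite diagonal value of the kernel. -/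
lemma measure_singleton_eq_zero_of_mutualEnergy_ne_top {D : ℝ} (hD : 0 < D) {μ : Measure ℂ}
    (h : mutualEnergy D μ μ ≠ ⊤) (p : ℂ) : μ {p} = 0 := by
  by_contra hp
  refine h (top_le_iff.1 ?_)
  calc ⊤ = ∫⁻ _ in {p}, ∫⁻ _ in {p}, ⊤ ∂μ ∂μ := by simp [hp]
    _ ≤ ∫⁻ z in {p}, ∫⁻ w in {p}, kern D z w ∂μ ∂μ := by
        refine setLIntegral_mono' (measurableSet_singleton p) fun z hz => ?_
        refine setLIntegral_mono' (measurableSet_singleton p) fun w hw => ?_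
        rw [hz, hw, kern_self hD]
    _ ≤ mutualEnergy D μ μ := mutualEnergy_mono D Measure.restrict_le_self Measure.restrict_le_self

/-! ### From the logarithmic energy to the nonnegative kernel -/

lemma eintegral_congr_ae {μ : Measure ℂ} {f g : ℂ → EReal} (h : f =ᵐ[μ] g) :
    eintegral μ f = eintegral μ g := by
  unfold eintegral
  rw [lintegral_congr_ae (h.mono fun x hx => by simp only [hx] :
      (fun x => (f x).toENNReal) =ᵐ[μ] fun x => (g x).toENNReal),
    lintegral_congr_ae (h.mono fun x hx => by simp only [hx] :
      (fun x => (-f x).toENNReal) =ᵐ[μ] fun x => (-g x).toENNReal)]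

/-- The positive and negative parts of g - c are the truncated differences g - c and c - g. The
second has finite integral because it is at most c and μ has mass one, so the identity persists when
g has infinite integral. -/
lemma eintegral_coe_sub {μ : Measure ℂ} [IsProbabilityMeasure μ] {g : ℂ → ℝ≥0∞}
    (hg : Measurable g) {c : ℝ} (hc : 0 ≤ c) :
    eintegral μ (fun x => (g x : EReal) - (c : EReal)) =
      ((∫⁻ x, g x ∂μ : ℝ≥0∞) : EReal) - (c : EReal) := by
  have hcoe : (c : EReal) = ((ENNReal.ofReal c : ℝ≥0∞) : EReal) := by
    rw [EReal.coe_ennreal_ofReal, max_eq_left hc]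
  have hpos : ∀ x, ((g x : EReal) - (c : EReal)).toENNReal = g x - ENNReal.ofReal c := by
    intro x
    rw [hcoe, EReal.toENNReal_sub (by simp), EReal.toENNReal_coe, EReal.toENNReal_coe]
  have hneg : ∀ x, (-((g x : EReal) - (c : EReal))).toENNReal = ENNReal.ofReal c - g x := by
    intro x
    rw [EReal.neg_sub (Or.inr (EReal.coe_ne_bot c)) (Or.inr (EReal.coe_ne_top c)), add_comm,
      ← sub_eq_add_neg, hcoe, EReal.toENNReal_sub (EReal.coe_ennreal_nonneg _), EReal.toENNReal_coe,
      EReal.toENNReal_coe]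
  have key : (∫⁻ x, (g x - ENNReal.ofReal c) ∂μ) + ENNReal.ofReal c =
      (∫⁻ x, (ENNReal.ofReal c - g x) ∂μ) + ∫⁻ x, g x ∂μ := by
    have h1 : ENNReal.ofReal c = ∫⁻ _, ENNReal.ofReal c ∂μ := by simp
    conv_lhs => rw [h1]
    rw [← lintegral_add_right _ measurable_const, ← lintegral_add_right _ hg]
    refine lintegral_congr fun x => ?_
    rw [← h1]
    rcases le_total (g x) (ENNReal.ofReal c) with h | h
    · rw [tsub_eq_zero_of_le h, zero_add, tsub_add_cancel_of_le h]
    · rw [tsub_eq_zero_of_le h, zero_add, tsub_add_cancel_of_le h]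
  have hfin : (∫⁻ x, (ENNReal.ofReal c - g x) ∂μ) ≠ ⊤ := by
    refine ne_top_of_le_ne_top (b := ∫⁻ _, ENNReal.ofReal c ∂μ) (by simp) ?_
    exact lintegral_mono fun x => tsub_le_self
  simp only [eintegral, hpos, hneg]
  clear hpos hneg
  rw [hcoe]
  have hc' : ENNReal.ofReal c ≠ ⊤ := by simp
  generalize (∫⁻ x, (g x - ENNReal.ofReal c) ∂μ) = a at *
  generalize (∫⁻ x, (ENNReal.ofReal c - g x) ∂μ) = b at *
  generalize (∫⁻ x, g x ∂μ) = G at *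
  generalize ENNReal.ofReal c = c' at *
  clear hcoe
  by_cases hG : G = ⊤
  · have ha : a = ⊤ := by
      rw [hG, add_top] at key
      exact (ENNReal.add_eq_top.1 key).resolve_right hc'
    rw [hG, ha]
    lift b to NNReal using hfin
    lift c' to NNReal using hc'
    rfl
  · have ha : a ≠ ⊤ := by
      intro ha
      rw [ha, top_add] at key
      exact (ENNReal.add_ne_top.2 ⟨hfin, hG⟩) key.symm
    lift a to NNReal using ha
    lift b to NNReal using hfin
    lift c' to NNReal using hc'
    lift G to NNReal using hG
    norm_cast at key
    have : (a : ℝ) + c' = b + G := by exact_mod_cast key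
    have h2 : (a : ℝ) - b = G - c' := by linarith
    have h3 := congrArg (fun t : ℝ => (t : EReal)) h2
    simpa only [EReal.coe_sub, EReal.coe_nnreal_eq_coe_real] using h3

/-- At distance at most D the logarithm of D / |z - w| is nonnegative, so taking the positive part
changes nothing; on the diagonal both sides are +∞. -/
lemma logKernel_eq_kern_sub {D : ℝ} (hD : 0 < D) {z w : ℂ} (h : ‖z - w‖ ≤ D) :
    logKernel z w = (kern D z w : EReal) - (Real.log D : EReal) := by
  by_cases hzw : z = w
  · simp [hzw, kern_self hD, logKernel]
  · have h' : 0 < ‖z - w‖ := norm_pos_iff.2 (sub_ne_zero.2 hzw)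
    rw [logKernel, kern_of_ne hD hzw, ← ofReal_norm, ENNReal.log_ofReal_of_pos h',
      EReal.coe_ennreal_ofReal, max_eq_left (Real.log_nonneg ((one_le_div h').2 h)),
      Real.log_div hD.ne' h'.ne']
    norm_cast
    ring

lemma energy_eq_mutualEnergy_sub {D : ℝ} (hD : 1 ≤ D) {K : Set ℂ}
    (hK : ∀ z ∈ K, ∀ w ∈ K, ‖z - w‖ ≤ D) {μ : Measure ℂ} [IsProbabilityMeasure μ]
    (hμ : μ Kᶜ = 0) : energy μ = (mutualEnergy D μ μ : EReal) - (Real.log D : EReal) := by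
  have hD0 : 0 < D := by linarith
  have hae : ∀ᵐ z ∂μ, z ∈ K := (measure_eq_zero_iff_ae_notMem.1 hμ).mono fun z hz => not_not.1 hz
  have hpot : ∀ z ∈ K, potential μ z =
      ((∫⁻ w, kern D z w ∂μ : ℝ≥0∞) : EReal) - (Real.log D : EReal) := by
    intro z hz
    rw [potential, ← eintegral_coe_sub (measurable_kern_right hD0 z) (Real.log_nonneg hD)]
    exact eintegral_congr_ae (hae.mono fun w hw => logKernel_eq_kern_sub hD0 (hK z hz w hw))
  rw [energy, mutualEnergy, ← eintegral_coe_sub (measurable_lintegral_kern hD0 μ)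
    (Real.log_nonneg hD)]
  exact eintegral_congr_ae (hae.mono fun z hz => hpot z hz)

/-! ### Positive definiteness of Gaussian kernels -/

lemma charFun_mul_conj_charFun (μ ν : Measure ℂ) [IsFiniteMeasure μ] [IsFiniteMeasure ν] (ξ : ℂ) :
    charFun μ ξ * conj (charFun ν ξ) =
      ∫ p : ℂ × ℂ, Complex.exp (Complex.I * (inner ℝ (p.1 - p.2) ξ : ℝ)) ∂(μ.prod ν) := by
  rw [← charFun_neg, charFun_apply, charFun_apply, ← integral_prod_mul]
  refine integral_congr_ae (ae_of_all _ fun p => ?_)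
  simp only
  rw [← Complex.exp_add, inner_sub_left, inner_neg_right]
  congr 1
  push_cast
  ring

lemma integrable_gaussian {b : ℝ} (hb : 0 < b) :
    Integrable (fun ξ : ℂ => Real.exp (-b * ‖ξ‖ ^ 2)) := by
  have := (GaussianFourier.integrable_cexp_neg_mul_sq_norm_add (V := ℂ) (b := b)
    (by simpa using hb) 0 0).norm
  refine this.congr (ae_of_all _ fun ξ => ?_)
  simp [Complex.norm_exp, ← Complex.ofReal_pow]

/-- The mutual energy for a Gaussian kernel as a weighted `L²` inner product of characteristic
functions. -/
lemma integral_gaussian_mul_charFun (μ ν : Measure ℂ) [IsFiniteMeasure μ] [IsFiniteMeasure ν]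
    {b : ℝ} (hb : 0 < b) :
    ∫ ξ : ℂ, ((Real.exp (-b * ‖ξ‖ ^ 2) : ℝ) : ℂ) * (charFun μ ξ * conj (charFun ν ξ)) =
      ((Real.pi / b * ∫ p : ℂ × ℂ, Real.exp (-‖p.1 - p.2‖ ^ 2 / (4 * b)) ∂(μ.prod ν) : ℝ) : ℂ) := by
  simp_rw [charFun_mul_conj_charFun, ← integral_const_mul]
  rw [integral_integral_swap]
  · rw [← integral_complex_ofReal]
    refine integral_congr_ae (ae_of_all _ fun p => ?_)
    have h := GaussianFourier.integral_cexp_neg_mul_sq_norm_add (V := ℂ) (b := b)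
      (by simpa using hb) Complex.I (p.1 - p.2)
    simp only
    rw [Complex.finrank_real_complex, Nat.cast_ofNat, div_self (two_ne_zero' ℂ),
      Complex.cpow_one, Complex.I_sq, neg_one_mul] at h
    push_cast
    rw [← h]
    refine integral_congr_ae (ae_of_all _ fun ξ => ?_)
    simp only
    rw [← Complex.exp_add]
  · have h1 : Integrable (fun q : ℂ × (ℂ × ℂ) => Real.exp (-b * ‖q.1‖ ^ 2) * (1 : ℝ))
        (volume.prod (μ.prod ν)) := (integrable_gaussian hb).mul_prod (integrable_const (1 : ℝ))
    refine h1.mono' (Continuous.aestronglyMeasurable (by fun_prop)) (ae_of_all _ fun q => ?_)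
    simp only [Function.uncurry, norm_mul, Complex.norm_real, Real.norm_eq_abs, Real.abs_exp]
    rw [mul_comm Complex.I, Complex.norm_exp_ofReal_mul_I]

/-- The mutual energy for the kernel `exp (-u |z - w|²)`. -/
def gaussEnergy (u : ℝ) (μ ν : Measure ℂ) : ℝ :=
  ∫ p : ℂ × ℂ, Real.exp (-u * ‖p.1 - p.2‖ ^ 2) ∂(μ.prod ν)

lemma gaussEnergy_comm (u : ℝ) (μ ν : Measure ℂ) [SFinite μ] [SFinite ν] :
    gaussEnergy u μ ν = gaussEnergy u ν μ := by
  rw [gaussEnergy, ← integral_prod_swap]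
  simp only [gaussEnergy, Prod.fst_swap, Prod.snd_swap, norm_sub_rev]

lemma integrable_gaussian_mul {b : ℝ} (hb : 0 < b) {f : ℂ → ℂ} (hf : Continuous f) {C : ℝ}
    (hC : ∀ ξ, ‖f ξ‖ ≤ C) :
    Integrable fun ξ : ℂ => ((Real.exp (-b * ‖ξ‖ ^ 2) : ℝ) : ℂ) * f ξ := by
  refine ((integrable_gaussian hb).mul_const C).mono'
    (Continuous.aestronglyMeasurable (by fun_prop)) (ae_of_all _ fun ξ => ?_)
  rw [norm_mul, Complex.norm_real, Real.norm_eq_abs, Real.abs_exp]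
  gcongr
  exact hC ξ

lemma integral_gaussian_mul_charFun_sub {b : ℝ} (hb : 0 < b) (μ ν : Measure ℂ)
    [IsProbabilityMeasure μ] [IsProbabilityMeasure ν] :
    ∫ ξ : ℂ, Real.exp (-b * ‖ξ‖ ^ 2) * ‖charFun μ ξ - charFun ν ξ‖ ^ 2 =
      Real.pi / b * (gaussEnergy (1 / (4 * b)) μ μ + gaussEnergy (1 / (4 * b)) ν ν -
        2 * gaussEnergy (1 / (4 * b)) μ ν) := by
  have hG : ∀ μ ν : Measure ℂ, ∫ p : ℂ × ℂ, Real.exp (-‖p.1 - p.2‖ ^ 2 / (4 * b)) ∂(μ.prod ν) =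
      gaussEnergy (1 / (4 * b)) μ ν := by
    intro μ ν
    refine integral_congr_ae (ae_of_all _ fun p => ?_)
    simp only
    congr 1
    ring
  have hI : ∀ μ ν : Measure ℂ, [IsProbabilityMeasure μ] → [IsProbabilityMeasure ν] →
      Integrable fun ξ : ℂ =>
        ((Real.exp (-b * ‖ξ‖ ^ 2) : ℝ) : ℂ) * (charFun μ ξ * conj (charFun ν ξ)) := by
    intro μ ν _ _
    refine integrable_gaussian_mul hb (C := 1) ?_ fun ξ => ?_
    · exact continuous_charFun.mul (Complex.continuous_conj.comp continuous_charFun)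
    · rw [norm_mul, RCLike.norm_conj]
      exact mul_le_one₀ (norm_charFun_le_one ξ) (norm_nonneg _) (norm_charFun_le_one ξ)
  rw [← Complex.ofReal_inj, ← integral_complex_ofReal]
  let F (μ ν : Measure ℂ) (ξ : ℂ) : ℂ :=
    ((Real.exp (-b * ‖ξ‖ ^ 2) : ℝ) : ℂ) * (charFun μ ξ * conj (charFun ν ξ))
  have hF : ∀ μ ν : Measure ℂ, [IsProbabilityMeasure μ] → [IsProbabilityMeasure ν] →
      ∫ ξ, F μ ν ξ = ((Real.pi / b * gaussEnergy (1 / (4 * b)) μ ν : ℝ) : ℂ) := by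
    intro μ ν _ _
    rw [integral_gaussian_mul_charFun _ _ hb, hG]
  -- The squared modulus expands into four products; the two mixed ones integrate to the same value
  -- because the Gaussian kernel is symmetric.
  have hexp : (fun ξ : ℂ => ((Real.exp (-b * ‖ξ‖ ^ 2) * ‖charFun μ ξ - charFun ν ξ‖ ^ 2 : ℝ) : ℂ)) =
      F μ μ + F ν ν - F μ ν - F ν μ := by
    funext ξ
    simp only [F, Pi.add_apply, Pi.sub_apply]
    rw [Complex.ofReal_mul, ← Complex.normSq_eq_norm_sq (charFun μ ξ - _), ← Complex.mul_conj,
      map_sub]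
    ring
  rw [hexp, integral_sub' (((hI μ μ).add (hI ν ν)).sub (hI μ ν)) (hI ν μ),
    integral_sub' ((hI μ μ).add (hI ν ν)) (hI μ ν), integral_add' (hI μ μ) (hI ν ν)]
  rw [hF μ μ, hF ν ν, hF μ ν, hF ν μ]
  rw [gaussEnergy_comm _ ν μ]
  push_cast
  ring

/-- Positive semidefiniteness of the Gaussian kernel. -/
lemma two_mul_gaussEnergy_le {u : ℝ} (hu : 0 < u) (μ ν : Measure ℂ)
    [IsProbabilityMeasure μ] [IsProbabilityMeasure ν] :
    2 * gaussEnergy u μ ν ≤ gaussEnergy u μ μ + gaussEnergy u ν ν := by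
  have hb : 0 < 1 / (4 * u) := by positivity
  have h := integral_gaussian_mul_charFun_sub hb μ ν
  rw [show 1 / (4 * (1 / (4 * u))) = u by field_simp] at h
  have h0 : 0 ≤ ∫ ξ : ℂ, Real.exp (-(1 / (4 * u)) * ‖ξ‖ ^ 2) * ‖charFun μ ξ - charFun ν ξ‖ ^ 2 :=
    integral_nonneg fun ξ => by positivity
  rw [h] at h0
  have := nonneg_of_mul_nonneg_right h0 (by positivity)
  linarith

/-- Strict positive definiteness of the Gaussian kernel. -/
lemma two_mul_gaussEnergy_lt {u : ℝ} (hu : 0 < u) {μ ν : Measure ℂ}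
    [IsProbabilityMeasure μ] [IsProbabilityMeasure ν] (hμν : μ ≠ ν) :
    2 * gaussEnergy u μ ν < gaussEnergy u μ μ + gaussEnergy u ν ν := by
  refine lt_of_le_of_ne (two_mul_gaussEnergy_le hu μ ν) fun heq => hμν ?_
  have hb : 0 < 1 / (4 * u) := by positivity
  have h := integral_gaussian_mul_charFun_sub hb μ ν
  rw [show 1 / (4 * (1 / (4 * u))) = u by field_simp, ← heq, sub_self, mul_zero] at h
  have hcont : Continuous fun ξ : ℂ =>
      Real.exp (-(1 / (4 * u)) * ‖ξ‖ ^ 2) * ‖charFun μ ξ - charFun ν ξ‖ ^ 2 := by fun_prop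
  have hint : Integrable fun ξ : ℂ =>
      Real.exp (-(1 / (4 * u)) * ‖ξ‖ ^ 2) * ‖charFun μ ξ - charFun ν ξ‖ ^ 2 := by
    refine ((integrable_gaussian hb).mul_const 4).mono' hcont.aestronglyMeasurable
      (ae_of_all _ fun ξ => ?_)
    rw [Real.norm_eq_abs, abs_of_nonneg (by positivity)]
    have h1 : ‖charFun μ ξ - charFun ν ξ‖ ≤ 2 :=
      (norm_sub_le _ _).trans (by
        linarith [norm_charFun_le_one (μ := μ) ξ, norm_charFun_le_one (μ := ν) ξ])
    have : ‖charFun μ ξ - charFun ν ξ‖ ^ 2 ≤ 4 := by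
      nlinarith [norm_nonneg (charFun μ ξ - charFun ν ξ)]
    gcongr
  rw [integral_eq_zero_iff_of_nonneg (fun ξ => by positivity) hint] at h
  -- A continuous function that vanishes almost everywhere for Lebesgue measure vanishes everywhere,
  -- so the characteristic functions agree at every point.
  have h2 := hcont.ae_eq_iff_eq volume continuous_const |>.1 h
  refine Measure.ext_of_charFun (funext fun ξ => ?_)
  have h3 := congrFun h2 ξ
  have h4 := (mul_eq_zero.1 h3).resolve_left (Real.exp_ne_zero _)
  exact sub_eq_zero.1 (norm_eq_zero.1 (pow_eq_zero_iff two_ne_zero |>.1 h4))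

/-! ### The logarithmic kernel as a mixture of Gaussians -/

lemma lintegral_exp_neg_mul_Ioi {c : ℝ} (hc : 0 < c) :
    ∫⁻ u in Ioi (0 : ℝ), ENNReal.ofReal (Real.exp (-u * c)) = ENNReal.ofReal (1 / c) := by
  have hint : IntegrableOn (fun u : ℝ => Real.exp (-u * c)) (Ioi 0) := by
    simpa [mul_comm] using exp_neg_integrableOn_Ioi 0 hc
  rw [← ofReal_integral_eq_lintegral_ofReal hint (ae_of_all _ fun u => (Real.exp_pos _).le)]
  congr 1
  have := integral_exp_mul_Ioi (a := -c) (by linarith) 0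
  simp only [mul_zero, Real.exp_zero] at this
  rw [← neg_div_neg_eq, ← this]
  exact integral_congr_ae (ae_of_all _ fun u => by simp only; congr 1; ring)

lemma lintegral_one_div_add_Ioc {A t : ℝ} (hA : 0 < A) (ht : 0 < t) :
    ∫⁻ a in Ioc (0 : ℝ) A, ENNReal.ofReal (1 / (t + a)) =
      ENNReal.ofReal (Real.log ((t + A) / t)) := by
  have hint : IntervalIntegrable (fun a : ℝ => 1 / (t + a)) volume 0 A := by
    refine ContinuousOn.intervalIntegrable fun a ha => ?_
    rw [uIcc_of_le hA.le] at ha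
    have : t + a ≠ 0 := by linarith [ha.1]
    fun_prop (disch := assumption)
  rw [← ofReal_integral_eq_lintegral_ofReal
    ((intervalIntegrable_iff_integrableOn_Ioc_of_le hA.le).1 hint)]
  · congr 1
    rw [← intervalIntegral.integral_of_le hA.le,
      intervalIntegral.integral_comp_add_left (fun a => 1 / a) t, add_zero,
      integral_one_div_of_pos ht (by linarith)]
  · filter_upwards [ae_restrict_mem measurableSet_Ioc] with a ha
    have := ha.1
    simp only [Pi.zero_apply]
    positivity

/-- The function `log ((s² + A) / s²)` as a mixture of Gaussians in `s`. -/
def gaussMixture (A s : ℝ) : ℝ≥0∞ :=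
  ∫⁻ q in Ioc (0 : ℝ) A ×ˢ Ioi (0 : ℝ),
    ENNReal.ofReal (Real.exp (-q.2 * q.1)) * ENNReal.ofReal (Real.exp (-q.2 * s ^ 2))

/-- Integrating exp(-u(a + s²)) over u > 0 gives 1/(a + s²), whose integral over 0 < a ≤ A is the
logarithm. -/
lemma gaussMixture_eq {A s : ℝ} (hA : 0 < A) (hs : 0 < s) :
    gaussMixture A s = ENNReal.ofReal (Real.log ((s ^ 2 + A) / s ^ 2)) := by
  rw [gaussMixture, Measure.volume_eq_prod, ← Measure.prod_restrict, lintegral_prod _ (by fun_prop),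
    ← lintegral_one_div_add_Ioc hA (by positivity)]
  refine setLIntegral_congr_fun measurableSet_Ioc fun a ha => ?_
  simp only
  rw [← lintegral_exp_neg_mul_Ioi (by have := ha.1; positivity)]
  refine lintegral_congr fun u => ?_
  rw [← ENNReal.ofReal_mul (Real.exp_pos _).le, ← Real.exp_add]
  ring_nf

/-- The mutual energy for the kernel `gaussMixture A |z - w|`. -/
def mixtureEnergy (A : ℝ) (μ ν : Measure ℂ) : ℝ≥0∞ :=
  ∫⁻ p, gaussMixture A ‖p.1 - p.2‖ ∂(μ.prod ν)

lemma ofReal_gaussEnergy {u : ℝ} (hu : 0 ≤ u) (μ ν : Measure ℂ) [IsFiniteMeasure μ]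
    [IsFiniteMeasure ν] : ENNReal.ofReal (gaussEnergy u μ ν) =
      ∫⁻ p, ENNReal.ofReal (Real.exp (-u * ‖p.1 - p.2‖ ^ 2)) ∂(μ.prod ν) := by
  refine ofReal_integral_eq_lintegral_ofReal ?_ (ae_of_all _ fun p => (Real.exp_pos _).le)
  refine (integrable_const (1 : ℝ)).mono' (Continuous.aestronglyMeasurable (by fun_prop))
    (ae_of_all _ fun p => ?_)
  rw [Real.norm_eq_abs, Real.abs_exp, Real.exp_le_one_iff]
  nlinarith [sq_nonneg ‖p.1 - p.2‖]

lemma gaussEnergy_nonneg (u : ℝ) (μ ν : Measure ℂ) : 0 ≤ gaussEnergy u μ ν :=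
  integral_nonneg fun _ => (Real.exp_pos _).le

@[fun_prop]
lemma measurable_gaussEnergy (μ ν : Measure ℂ) [IsFiniteMeasure μ] [IsFiniteMeasure ν] :
    Measurable fun u => gaussEnergy u μ ν := by
  have : StronglyMeasurable (Function.uncurry fun (u : ℝ) (p : ℂ × ℂ) =>
      Real.exp (-u * ‖p.1 - p.2‖ ^ 2)) := Continuous.stronglyMeasurable (by fun_prop)
  exact this.integral_prod_right.measurable

lemma mixtureEnergy_eq (A : ℝ) (μ ν : Measure ℂ) [IsFiniteMeasure μ] [IsFiniteMeasure ν] :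
    mixtureEnergy A μ ν = ∫⁻ q in Ioc (0 : ℝ) A ×ˢ Ioi (0 : ℝ),
      ENNReal.ofReal (Real.exp (-q.2 * q.1)) * ENNReal.ofReal (gaussEnergy q.2 μ ν) := by
  simp only [mixtureEnergy, gaussMixture]
  rw [lintegral_lintegral_swap (Measurable.aemeasurable (by fun_prop))]
  refine setLIntegral_congr_fun (measurableSet_Ioc.prod measurableSet_Ioi) fun q hq => ?_
  rw [lintegral_const_mul _ (by fun_prop), ofReal_gaussEnergy (le_of_lt hq.2)]

/-- The Gaussian mixture energy of the difference of two measures. -/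
def mixtureDefect (A : ℝ) (μ ν : Measure ℂ) : ℝ≥0∞ :=
  ∫⁻ q in Ioc (0 : ℝ) A ×ˢ Ioi (0 : ℝ), ENNReal.ofReal (Real.exp (-q.2 * q.1)) *
    ENNReal.ofReal (gaussEnergy q.2 μ μ + gaussEnergy q.2 ν ν - 2 * gaussEnergy q.2 μ ν)

/-- Gaussian positive definiteness makes the integrand of the defect nonnegative. Stated additively,
the identity needs no finiteness of the energies. -/
lemma mixtureEnergy_add (A : ℝ) (μ ν : Measure ℂ) [IsProbabilityMeasure μ]
    [IsProbabilityMeasure ν] : mixtureEnergy A μ μ + mixtureEnergy A ν ν =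
      2 * mixtureEnergy A μ ν + mixtureDefect A μ ν := by
  simp only [mixtureEnergy_eq, mixtureDefect]
  rw [← lintegral_const_mul _ (by fun_prop), ← lintegral_add_left (by fun_prop),
    ← lintegral_add_left (by fun_prop)]
  refine setLIntegral_congr_fun (measurableSet_Ioc.prod measurableSet_Ioi) fun q hq => ?_
  rw [mul_left_comm, ← mul_add, ← mul_add]
  congr 1
  have h := two_mul_gaussEnergy_le hq.2 μ ν
  have g1 := gaussEnergy_nonneg q.2 μ μ
  have g2 := gaussEnergy_nonneg q.2 ν ν
  have g3 := gaussEnergy_nonneg q.2 μ ν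
  rw [← ENNReal.ofReal_add g1 g2, show (2 : ℝ≥0∞) = ENNReal.ofReal 2 by simp,
    ← ENNReal.ofReal_mul zero_le_two, ← ENNReal.ofReal_add (by positivity) (by linarith)]
  congr 1
  ring

lemma mixtureDefect_mono {A B : ℝ} (h : A ≤ B) (μ ν : Measure ℂ) :
    mixtureDefect A μ ν ≤ mixtureDefect B μ ν :=
  lintegral_mono_set (prod_mono (Ioc_subset_Ioc_right h) le_rfl)

lemma mixtureDefect_pos {A : ℝ} (hA : 0 < A) {μ ν : Measure ℂ} [IsProbabilityMeasure μ]
    [IsProbabilityMeasure ν] (hμν : μ ≠ ν) : 0 < mixtureDefect A μ ν := by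
  rw [mixtureDefect, setLIntegral_pos_iff (by fun_prop)]
  have : Ioc (0 : ℝ) A ×ˢ Ioi (0 : ℝ) ⊆ (Function.support fun q : ℝ × ℝ =>
      ENNReal.ofReal (Real.exp (-q.2 * q.1)) *
    ENNReal.ofReal (gaussEnergy q.2 μ μ + gaussEnergy q.2 ν ν - 2 * gaussEnergy q.2 μ ν)) ∩
      Ioc (0 : ℝ) A ×ˢ Ioi (0 : ℝ) := by
    refine subset_inter (fun q hq => ?_) subset_rfl
    have := two_mul_gaussEnergy_lt hq.2 hμν
    rw [Function.mem_support]
    refine mul_ne_zero ?_ ?_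
    · exact (ENNReal.ofReal_pos.2 (Real.exp_pos _)).ne'
    · exact (ENNReal.ofReal_pos.2 (by linarith)).ne'
  refine lt_of_lt_of_le ?_ (measure_mono this)
  rw [Measure.volume_eq_prod, Measure.prod_prod]
  simp [hA]

/-- All four logarithms are nonnegative, so the real identity survives in `ℝ≥0∞`. The last term lies
between 0 and log((A + D²)/A), hence disappears as A → ∞. -/
lemma two_mul_kern_add {D A : ℝ} (hA : 0 < A) {z w : ℂ} (hzw : z ≠ w)
    (h : ‖z - w‖ ≤ D) :
    2 * kern D z w + ENNReal.ofReal (Real.log ((A + D ^ 2) / D ^ 2)) =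
      gaussMixture A ‖z - w‖ + ENNReal.ofReal (Real.log ((A + D ^ 2) / (A + ‖z - w‖ ^ 2))) := by
  have hs : 0 < ‖z - w‖ := norm_pos_iff.2 (sub_ne_zero.2 hzw)
  have hD : 0 < D := hs.trans_le h
  rw [kern_of_ne hD hzw, gaussMixture_eq hA hs]
  set s := ‖z - w‖
  have l1 : 0 ≤ Real.log (D / s) := Real.log_nonneg ((one_le_div hs).2 h)
  have l2 : 0 ≤ Real.log ((A + D ^ 2) / D ^ 2) :=
    Real.log_nonneg ((one_le_div (by positivity)).2 (by linarith))
  have l3 : 0 ≤ Real.log ((s ^ 2 + A) / s ^ 2) :=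
    Real.log_nonneg ((one_le_div (by positivity)).2 (by linarith))
  have l4 : 0 ≤ Real.log ((A + D ^ 2) / (A + s ^ 2)) :=
    Real.log_nonneg ((one_le_div (by positivity)).2 (by gcongr))
  rw [show (2 : ℝ≥0∞) = ENNReal.ofReal 2 by simp, ← ENNReal.ofReal_mul zero_le_two,
    ← ENNReal.ofReal_add (by positivity) l2, ← ENNReal.ofReal_add l3 l4]
  congr 1
  rw [Real.log_div hD.ne' hs.ne', Real.log_div (by positivity) (by positivity),
    Real.log_div (by positivity) (by positivity), Real.log_div (by positivity) (by positivity),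
    Real.log_pow, Real.log_pow, add_comm A (s ^ 2)]
  push_cast
  ring

lemma ae_prod_ne {μ ν : Measure ℂ} [SFinite ν] (hν : ∀ p, ν {p} = 0) :
    ∀ᵐ p ∂(μ.prod ν), p.1 ≠ p.2 := by
  rw [ae_iff]
  simp only [ne_eq, not_not]
  rw [Measure.measure_prod_null (measurableSet_eq_fun measurable_fst measurable_snd)]
  refine ae_of_all _ fun z => ?_
  have : Prod.mk z ⁻¹' {p : ℂ × ℂ | p.1 = p.2} = {z} := by
    ext w; simp [eq_comm]
  change ν (Prod.mk z ⁻¹' {p : ℂ × ℂ | p.1 = p.2}) = 0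
  rw [this]
  exact hν z

lemma ae_prod_mem {μ ν : Measure ℂ} [SFinite ν] {K : Set ℂ} (hμ : μ Kᶜ = 0) (hν : ν Kᶜ = 0) :
    ∀ᵐ p ∂(μ.prod ν), p.1 ∈ K ∧ p.2 ∈ K := by
  have h1 : ∀ᵐ z ∂μ, z ∈ K := (measure_eq_zero_iff_ae_notMem.1 hμ).mono fun z hz => not_not.1 hz
  have h2 : ∀ᵐ z ∂ν, z ∈ K := (measure_eq_zero_iff_ae_notMem.1 hν).mono fun z hz => not_not.1 hz
  exact (Measure.quasiMeasurePreserving_fst.ae h1).and (Measure.quasiMeasurePreserving_snd.ae h2)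

lemma measurable_gaussMixture (A : ℝ) :
    Measurable fun p : ℂ × ℂ => gaussMixture A ‖p.1 - p.2‖ := by
  unfold gaussMixture
  exact Measurable.lintegral_prod_right (f := fun (p : ℂ × ℂ) (q : ℝ × ℝ) =>
    ENNReal.ofReal (Real.exp (-q.2 * q.1)) *
      ENNReal.ofReal (Real.exp (-q.2 * ‖p.1 - p.2‖ ^ 2))) (by fun_prop)

lemma two_mul_mutualEnergy_add {D A : ℝ} (hD : 0 < D) (hA : 0 < A) {K : Set ℂ}
    (hK : ∀ z ∈ K, ∀ w ∈ K, ‖z - w‖ ≤ D) {μ ν : Measure ℂ} [IsProbabilityMeasure μ]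
    [IsProbabilityMeasure ν] (hμ : μ Kᶜ = 0) (hν : ν Kᶜ = 0) (hν' : ∀ p, ν {p} = 0) :
    2 * mutualEnergy D μ ν + ENNReal.ofReal (Real.log ((A + D ^ 2) / D ^ 2)) =
      mixtureEnergy A μ ν +
        ∫⁻ p, ENNReal.ofReal (Real.log ((A + D ^ 2) / (A + ‖p.1 - p.2‖ ^ 2))) ∂(μ.prod ν) := by
  rw [mutualEnergy_eq_lintegral_prod hD, mixtureEnergy,
    ← lintegral_add_left (measurable_gaussMixture A), ← lintegral_const_mul _ (measurable_kern hD)]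
  have hc : ENNReal.ofReal (Real.log ((A + D ^ 2) / D ^ 2)) =
      ∫⁻ _, ENNReal.ofReal (Real.log ((A + D ^ 2) / D ^ 2)) ∂(μ.prod ν) := by simp
  conv_lhs => rw [hc]
  rw [← lintegral_add_right _ measurable_const]
  refine lintegral_congr_ae ?_
  filter_upwards [ae_prod_ne (μ := μ) hν', ae_prod_mem hμ hν] with p hp hpK
  exact two_mul_kern_add hA hp (hK _ hpK.1 _ hpK.2)

/-- Strict positive definiteness of the logarithmic kernel on neutral signed measures. -/
lemma exists_two_mul_mutualEnergy_add_le {D : ℝ} (hD : 0 < D) {K : Set ℂ}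
    (hK : ∀ z ∈ K, ∀ w ∈ K, ‖z - w‖ ≤ D) {μ ν : Measure ℂ} [IsProbabilityMeasure μ]
    [IsProbabilityMeasure ν] (hμ : μ Kᶜ = 0) (hν : ν Kᶜ = 0) (hEμ : mutualEnergy D μ μ ≠ ⊤)
    (hEν : mutualEnergy D ν ν ≠ ⊤) (hμν : μ ≠ ν) :
    ∃ d : ℝ≥0∞, 0 < d ∧
      2 * mutualEnergy D μ ν + d ≤ mutualEnergy D μ μ + mutualEnergy D ν ν := by
  have hμ' := measure_singleton_eq_zero_of_mutualEnergy_ne_top hD hEμ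
  have hν' := measure_singleton_eq_zero_of_mutualEnergy_ne_top hD hEν
  -- Since μ and ν have equal mass, the constant c, which grows with A, occurs twice on either side
  -- and cancels. The defect increases with A, so its value at A = 1 is a lower bound independent of
  -- A.
  have key : ∀ A : ℝ, 1 ≤ A → 4 * mutualEnergy D μ ν + mixtureDefect 1 μ ν ≤
      2 * mutualEnergy D μ μ + 2 * mutualEnergy D ν ν +
        2 * ENNReal.ofReal (Real.log ((A + D ^ 2) / A)) := by
    intro A hA1
    have hA : 0 < A := by linarith
    have e1 := two_mul_mutualEnergy_add hD hA hK hμ hμ hμ'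
    have e2 := two_mul_mutualEnergy_add hD hA hK hν hν hν'
    have e3 := two_mul_mutualEnergy_add hD hA hK hμ hν hν'
    have e4 := mixtureEnergy_add A μ ν
    have e5 : ∫⁻ p, ENNReal.ofReal (Real.log ((A + D ^ 2) / (A + ‖p.1 - p.2‖ ^ 2))) ∂(μ.prod ν) ≤
        ENNReal.ofReal (Real.log ((A + D ^ 2) / A)) := by
      calc _ ≤ ∫⁻ _, ENNReal.ofReal (Real.log ((A + D ^ 2) / A)) ∂(μ.prod ν) := by
            refine lintegral_mono fun p => ?_
            gcongr
            linarith [sq_nonneg ‖p.1 - p.2‖]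
        _ = _ := by simp
    set c := ENNReal.ofReal (Real.log ((A + D ^ 2) / D ^ 2))
    set ε := ENNReal.ofReal (Real.log ((A + D ^ 2) / A))
    have hc : 2 * c ≠ ⊤ := ENNReal.mul_ne_top (by simp) ENNReal.ofReal_ne_top
    refine (ENNReal.add_le_add_iff_right hc).1 ?_
    calc 4 * mutualEnergy D μ ν + mixtureDefect 1 μ ν + 2 * c
        = 2 * (2 * mutualEnergy D μ ν + c) + mixtureDefect 1 μ ν := by ring
      _ ≤ 2 * (mixtureEnergy A μ ν + ε) + mixtureDefect A μ ν := by
          rw [e3]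
          gcongr
          exact mixtureDefect_mono hA1 μ ν
      _ = mixtureEnergy A μ μ + mixtureEnergy A ν ν + 2 * ε := by rw [e4]; ring
      _ ≤ (2 * mutualEnergy D μ μ + c) + (2 * mutualEnergy D ν ν + c) + 2 * ε := by
          rw [e1, e2]
          gcongr <;> exact le_self_add
      _ = _ := by ring
  have hlim : Tendsto (fun A : ℝ => 2 * mutualEnergy D μ μ + 2 * mutualEnergy D ν ν +
        2 * ENNReal.ofReal (Real.log ((A + D ^ 2) / A))) atTop
      (𝓝 (2 * mutualEnergy D μ μ + 2 * mutualEnergy D ν ν + 2 * ENNReal.ofReal (Real.log 1))) := by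
    have h1 : Tendsto (fun A : ℝ => (A + D ^ 2) / A) atTop (𝓝 1) := by
      have h2 : Tendsto (fun A : ℝ => 1 + D ^ 2 / A) atTop (𝓝 (1 + 0)) :=
        tendsto_const_nhds.add (tendsto_const_nhds.div_atTop tendsto_id)
      rw [add_zero] at h2
      refine h2.congr' ?_
      filter_upwards [eventually_gt_atTop 0] with A hA
      field_simp
    refine Tendsto.add tendsto_const_nhds (ENNReal.Tendsto.const_mul ?_ (Or.inr (by simp)))
    exact ENNReal.tendsto_ofReal (h1.log one_ne_zero)
  have hle := ge_of_tendsto hlim ((eventually_ge_atTop 1).mono key)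
  rw [Real.log_one, ENNReal.ofReal_zero, mul_zero, add_zero] at hle
  refine ⟨mixtureDefect 1 μ ν / 2, ENNReal.half_pos (mixtureDefect_pos one_pos hμν).ne', ?_⟩
  refine (ENNReal.mul_le_mul_iff_right (a := 2) (by simp) (by simp)).1 ?_
  calc 2 * (2 * mutualEnergy D μ ν + mixtureDefect 1 μ ν / 2)
      = 4 * mutualEnergy D μ ν + 2 * (mixtureDefect 1 μ ν / 2) := by ring
    _ = 4 * mutualEnergy D μ ν + mixtureDefect 1 μ ν := by
        rw [ENNReal.mul_div_cancel (by simp) (by simp)]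
    _ ≤ _ := hle
    _ = _ := by ring

/-! ### Measures of bounded potential -/

/-- A Borel section of a real coordinate on a compact set. -/
lemma exists_measurable_section {L : Set ℂ} (hL : IsCompact L) {f g : ℂ → ℝ} (hf : Continuous f)
    (hg : Continuous g) {j : ℝ × ℝ → ℂ} (hj : Continuous j) (hjfg : ∀ z, j (f z, g z) = z) :
    ∃ s : ℝ → ℂ, Measurable s ∧ ∀ t ∈ f '' L, s t ∈ L ∧ f (s t) = t := by
  -- The section picks in each fiber of f the point with the least g. Its sublevel sets over the
  -- image are images of compact sets, hence Borel; off the image `sInf ∅ = 0` explains the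
  -- condition 0 ≤ c below.
  set m : ℝ → ℝ := fun t => sInf (g '' (L ∩ f ⁻¹' {t}))
  have hcomp : ∀ t, IsCompact (g '' (L ∩ f ⁻¹' {t})) := fun t =>
    (hL.inter_right (isClosed_singleton.preimage hf)).image hg
  have hmin : ∀ t ∈ f '' L, ∃ z ∈ L, f z = t ∧ g z = m t := by
    rintro t ⟨z, hz, rfl⟩
    obtain ⟨y, ⟨hy, hy'⟩, hy''⟩ := (hcomp (f z)).sInf_mem ⟨g z, z, ⟨hz, rfl⟩, rfl⟩
    exact ⟨y, hy, hy', hy''⟩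
  have hm : Measurable m := by
    refine measurable_of_Iic fun c => ?_
    have h1 : m ⁻¹' Iic c =
        f '' (L ∩ g ⁻¹' Iic c) ∪ ((f '' L)ᶜ ∩ {_t : ℝ | (0 : ℝ) ≤ c}) := by
      ext t
      by_cases ht : t ∈ f '' L
      · simp only [mem_preimage, mem_Iic, mem_union, mem_inter_iff, mem_compl_iff, ht,
          not_true_eq_false, false_and, or_false]
        constructor
        · intro hc
          obtain ⟨z, hz, hzt, hzm⟩ := hmin t ht
          exact ⟨z, ⟨hz, by simpa [hzm] using hc⟩, hzt⟩
        · rintro ⟨z, ⟨hz, hzc⟩, hzt⟩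
          exact (csInf_le (hcomp t).bddBelow ⟨z, ⟨hz, hzt⟩, rfl⟩).trans hzc
      · have h2 : L ∩ f ⁻¹' {t} = ∅ := by
          ext z
          simp only [mem_inter_iff, mem_preimage, mem_singleton_iff, mem_empty_iff_false,
            iff_false, not_and]
          exact fun hz hzt => ht ⟨z, hz, hzt⟩
        have h3 : t ∉ f '' (L ∩ g ⁻¹' Iic c) := fun h => ht (image_mono inter_subset_left h)
        simp [m, h2, ht, h3]
    rw [h1]
    refine ((hL.inter_right (isClosed_Iic.preimage hg)).image hf).measurableSet.union ?_
    exact (hL.image hf).measurableSet.compl.inter (MeasurableSet.const _)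
  refine ⟨fun t => j (t, m t), hj.measurable.comp (measurable_id.prodMk hm), fun t ht => ?_⟩
  obtain ⟨z, hz, rfl, hzm⟩ := hmin t ht
  simp only
  rw [← hzm, hjfg]
  exact ⟨hz, rfl⟩

/-- The bound is a constant plus a function of x with finite integral over the whole line: outside
[-1, 1] the term -log |x| is nonpositive and can be dropped. -/
lemma kern_le_of_real_separation {D : ℝ} (hD : 0 < D) {z w : ℂ} {x : ℝ} (hx : x ≠ 0)
    (h : |x| ≤ ‖z - w‖) :
    kern D z w ≤ ENNReal.ofReal |Real.log D| +
      (Icc (-1 : ℝ) 1).indicator (fun x => ‖Real.log x‖ₑ) x := by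
  have hx' : 0 < |x| := abs_pos.2 hx
  refine (kern_le hD hx' h).trans ?_
  rw [Real.log_div hD.ne' hx'.ne', Real.log_abs]
  by_cases hx1 : x ∈ Icc (-1 : ℝ) 1
  · rw [indicator_of_mem hx1, ← ofReal_norm, ← ENNReal.ofReal_add (abs_nonneg _) (norm_nonneg _)]
    refine ENNReal.ofReal_le_ofReal ?_
    have h1 := le_abs_self (Real.log D)
    have h2 := neg_abs_le (Real.log x)
    rw [Real.norm_eq_abs]
    linarith
  · rw [indicator_of_notMem hx1, add_zero]
    refine ENNReal.ofReal_le_ofReal ?_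
    have h1 := le_abs_self (Real.log D)
    have h2 : 1 ≤ |x| := by
      by_contra hlt
      exact hx1 (abs_le.1 (not_le.1 hlt).le)
    have h3 := Real.log_nonneg h2
    rw [Real.log_abs] at h3
    linarith

lemma lintegral_indicator_log_ne_top :
    ∫⁻ x, (Icc (-1 : ℝ) 1).indicator (fun x => ‖Real.log x‖ₑ) x ≠ ⊤ := by
  rw [lintegral_indicator measurableSet_Icc]
  have h := (intervalIntegrable_iff_integrableOn_Icc_of_le (by norm_num)).1
    (intervalIntegral.intervalIntegrable_log' (a := -1) (b := 1))
  exact h.2.ne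

/-- A compact set whose image under a real coordinate contains an interval carries a probability
measure of bounded potential. -/
lemma exists_measure_bounded_potential {D : ℝ} (hD : 0 < D) {L : Set ℂ} (hL : IsCompact L)
    {f g : ℂ → ℝ} (hf : Continuous f) (hg : Continuous g) (hfl : ∀ z w, |f z - f w| ≤ ‖z - w‖)
    {j : ℝ × ℝ → ℂ} (hj : Continuous j) (hjfg : ∀ z, j (f z, g z) = z) {a b : ℝ} (hab : a < b)
    (hfL : Icc a b ⊆ f '' L) :
    ∃ σ : Measure ℂ, IsProbabilityMeasure σ ∧ σ Lᶜ = 0 ∧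
      ∃ B : ℝ≥0∞, B ≠ ⊤ ∧ ∀ z, ∫⁻ w, kern D z w ∂σ ≤ B := by
  obtain ⟨s, hs, hsL⟩ := exists_measurable_section hL hf hg hj hjfg
  set c : ℝ≥0∞ := (ENNReal.ofReal (b - a))⁻¹
  have hba : 0 < b - a := sub_pos.2 hab
  have hc : c ≠ ⊤ := ENNReal.inv_ne_top.2 (ENNReal.ofReal_pos.2 hba).ne'
  set ρ : Measure ℝ := c • volume.restrict (Icc a b)
  have hρ : IsProbabilityMeasure ρ := ⟨by
    simp only [ρ, c, Measure.smul_apply, Measure.restrict_apply_univ, Real.volume_Icc, smul_eq_mul]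
    exact ENNReal.inv_mul_cancel (ENNReal.ofReal_pos.2 hba).ne' ENNReal.ofReal_ne_top⟩
  refine ⟨ρ.map s, Measure.isProbabilityMeasure_map hs.aemeasurable, ?_, ?_⟩
  · rw [Measure.map_apply hs hL.measurableSet.compl]
    simp only [ρ, Measure.smul_apply, smul_eq_mul]
    rw [Measure.restrict_apply (hs hL.measurableSet.compl)]
    have : s ⁻¹' Lᶜ ∩ Icc a b = ∅ := by
      ext t
      simp only [mem_inter_iff, mem_preimage, mem_compl_iff, mem_empty_iff_false, iff_false,
        not_and]
      exact fun h ht => h (hsL t (hfL ht)).1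
    rw [this]; simp
  · set h : ℝ → ℝ≥0∞ := (Icc (-1 : ℝ) 1).indicator (fun x => ‖Real.log x‖ₑ) with hh
    have hmeas : Measurable h :=
      Measurable.indicator (Real.measurable_log.enorm) measurableSet_Icc
    refine ⟨c * (ENNReal.ofReal |Real.log D| * ENNReal.ofReal (b - a) + ∫⁻ x, h x), ?_, ?_⟩
    · refine ENNReal.mul_ne_top hc (ENNReal.add_ne_top.2 ⟨?_, lintegral_indicator_log_ne_top⟩)
      exact ENNReal.mul_ne_top ENNReal.ofReal_ne_top ENNReal.ofReal_ne_top
    · intro z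
      rw [lintegral_map (measurable_kern_right hD z) hs, lintegral_smul_measure, smul_eq_mul]
      gcongr
      -- As f does not increase distances, |z - s t| ≥ |f z - t|, so the potential is dominated by a
      -- one-dimensional logarithmic integral; translation invariance removes the dependence on z.
      calc ∫⁻ t in Icc a b, kern D z (s t)
          ≤ ∫⁻ t in Icc a b, (ENNReal.ofReal |Real.log D| + h (f z - t)) := by
            refine lintegral_mono_ae ?_
            have hne : ∀ᵐ t ∂(volume.restrict (Icc a b)), t ≠ f z :=
              ae_restrict_of_ae (by simp [ae_iff])
            filter_upwards [hne, ae_restrict_mem measurableSet_Icc] with t ht htm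
            refine kern_le_of_real_separation hD (sub_ne_zero.2 ht.symm) ?_
            have := hfl z (s t)
            rwa [(hsL t (hfL htm)).2] at this
        _ ≤ ENNReal.ofReal |Real.log D| * ENNReal.ofReal (b - a) + ∫⁻ t, h (f z - t) := by
            rw [lintegral_add_left measurable_const, setLIntegral_const, Real.volume_Icc]
            gcongr
            exact Measure.restrict_le_self
        _ = _ := by rw [lintegral_sub_left_eq_self h (f z)]

lemma exists_Icc_disjoint_finite {a b : ℝ} (hab : a < b) {F : Set ℝ} (hF : F.Finite) :
    ∃ a' b', a' < b' ∧ Icc a' b' ⊆ Icc a b ∧ Disjoint (Icc a' b') F := by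
  obtain ⟨x, hx, hxF⟩ : (Ioo a b \ F).Nonempty :=
    ((Ioo_infinite hab).sdiff hF).nonempty
  have hopen : IsOpen (Ioo a b \ F) := isOpen_Ioo.sdiff hF.isClosed
  obtain ⟨ε, hε, hball⟩ := Metric.isOpen_iff.1 hopen x ⟨hx, hxF⟩
  have hsub : Icc (x - ε / 2) (x + ε / 2) ⊆ Ioo a b \ F := by
    intro y hy
    refine hball ?_
    rw [Metric.mem_ball, Real.dist_eq, abs_lt]
    constructor <;> linarith [hy.1, hy.2]
  refine ⟨x - ε / 2, x + ε / 2, by linarith, fun y hy => Ioo_subset_Icc_self (hsub hy).1, ?_⟩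
  exact disjoint_left.2 fun y hy => (hsub hy).2

/-- An admissible compact set carries, off any finite set, a probability measure of bounded
potential. -/
lemma IsAdmissibleCompact.exists_measure {D : ℝ} (hD : 0 < D) {K : Set ℂ}
    (hK : IsAdmissibleCompact K) {e : Set ℂ} (he : e.Finite) :
    ∃ L ⊆ K \ e, IsCompact L ∧ ∃ σ : Measure ℂ, IsProbabilityMeasure σ ∧ σ Lᶜ = 0 ∧
      ∃ B : ℝ≥0∞, B ≠ ⊤ ∧ ∀ z, ∫⁻ w, kern D z w ∂σ ≤ B := by
  obtain ⟨x, hx, p, hp, q, hq, hpq⟩ := hK.exists_nontrivial_component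
  set C := connectedComponentIn K x
  have hC : IsPreconnected C := isPreconnected_connectedComponentIn
  have hCK : C ⊆ K := connectedComponentIn_subset K x
  have main : ∀ (f g : ℂ → ℝ) (j : ℝ × ℝ → ℂ), Continuous f → Continuous g → Continuous j →
      (∀ z w, |f z - f w| ≤ ‖z - w‖) → (∀ z, j (f z, g z) = z) → f p ≠ f q →
      ∃ L ⊆ K \ e, IsCompact L ∧ ∃ σ : Measure ℂ, IsProbabilityMeasure σ ∧ σ Lᶜ = 0 ∧
      ∃ B : ℝ≥0∞, B ≠ ⊤ ∧ ∀ z, ∫⁻ w, kern D z w ∂σ ≤ B := by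
    intro f g j hf hg hj hfl hjfg hne
    have hlt : min (f p) (f q) < max (f p) (f q) := min_lt_max.2 hne
    obtain ⟨a, b, hab, hsub, hdisj⟩ := exists_Icc_disjoint_finite hlt (he.image f)
    have hcover : Icc a b ⊆ f '' C := by
      refine hsub.trans ?_
      have := (hC.image f hf.continuousOn).ordConnected.uIcc_subset (mem_image_of_mem f hp)
        (mem_image_of_mem f hq)
      exact this
    -- The set is cut out of K rather than out of the component, which makes it compact at once; the
    -- component only serves to cover the interval.
    refine ⟨K ∩ f ⁻¹' Icc a b, ?_, hK.isCompact.inter_right (isClosed_Icc.preimage hf), ?_⟩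
    · rintro z ⟨hzK, hz⟩
      exact ⟨hzK, fun hze => disjoint_left.1 hdisj hz (mem_image_of_mem f hze)⟩
    · refine exists_measure_bounded_potential hD
        (hK.isCompact.inter_right (isClosed_Icc.preimage hf)) hf hg hfl hj hjfg hab ?_
      intro t ht
      obtain ⟨z, hz, rfl⟩ := hcover ht
      exact ⟨z, ⟨hCK hz, ht⟩, rfl⟩
  by_cases hre : p.re = q.re
  · refine main Complex.im Complex.re (fun t => ⟨t.2, t.1⟩) Complex.continuous_im
      Complex.continuous_re ?_ ?_ ?_ ?_
    · exact Complex.equivRealProdCLM.symm.continuous.comp continuous_swap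
    · intro z w
      rw [← Complex.sub_im]
      exact Complex.abs_im_le_norm _
    · intro z; rfl
    · exact fun him => hpq (Complex.ext hre him)
  · refine main Complex.re Complex.im (fun t => ⟨t.1, t.2⟩) Complex.continuous_re
      Complex.continuous_im ?_ ?_ ?_ hre
    · exact Complex.equivRealProdCLM.symm.continuous
    · intro z w
      rw [← Complex.sub_re]
      exact Complex.abs_re_le_norm _
    · intro z; rfl

/-! ### Lower bounds for measures of mass at most one -/

/-- Positive measures of mass at most one on `K`, of finite energy and with `φ` integrable. -/
structure IsTestMeasure (D : ℝ) (K : Set ℂ) (φ : ℂ → ℝ) (τ : Measure ℂ) : Prop where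
  mass_le : τ univ ≤ 1
  compl_eq_zero : τ Kᶜ = 0
  energy_ne_top : mutualEnergy D τ τ ≠ ⊤
  integrable : Integrable φ τ

/-- The total energy with respect to the kernel `kern D`. -/
def totalEnergy (D : ℝ) (φ : ℂ → ℝ) (τ : Measure ℂ) : ℝ :=
  (mutualEnergy D τ τ).toReal + 2 * ∫ x, φ x ∂τ

variable {D : ℝ} {K : Set ℂ} {φ : ℂ → ℝ}

lemma IsTestMeasure.isFiniteMeasure {τ : Measure ℂ} (h : IsTestMeasure D K φ τ) :
    IsFiniteMeasure τ := ⟨h.mass_le.trans_lt one_lt_top⟩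

lemma IsTestMeasure.mono {τ τ' : Measure ℂ} (h : IsTestMeasure D K φ τ) (hle : τ' ≤ τ) :
    IsTestMeasure D K φ τ' where
  mass_le := (hle univ).trans h.mass_le
  compl_eq_zero := le_zero_iff.1 ((hle _).trans h.compl_eq_zero.le)
  energy_ne_top := ne_top_of_le_ne_top h.energy_ne_top (mutualEnergy_mono D hle hle)
  integrable := h.integrable.mono_measure hle

lemma isTestMeasure_zero : IsTestMeasure D K φ 0 where
  mass_le := by simp
  compl_eq_zero := by simp
  energy_ne_top := by simp [mutualEnergy_zero_left]
  integrable := integrable_zero_measure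

lemma mutualEnergy_smul_smul (hD : 0 < D) (c : ℝ≥0∞) (μ : Measure ℂ) [SFinite μ] :
    mutualEnergy D (c • μ) (c • μ) = c ^ 2 * mutualEnergy D μ μ := by
  rw [mutualEnergy_smul_left, mutualEnergy_smul_right hD, pow_two, mul_assoc]

lemma totalEnergy_smul (hD : 0 < D) {t : ℝ} (ht : 0 ≤ t) (μ : Measure ℂ) [SFinite μ] :
    totalEnergy D φ (ENNReal.ofReal t • μ) =
      t ^ 2 * (mutualEnergy D μ μ).toReal + 2 * (t * ∫ x, φ x ∂μ) := by
  rw [totalEnergy, mutualEnergy_smul_smul hD, integral_smul_measure, ENNReal.toReal_mul,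
    ENNReal.toReal_pow, ENNReal.toReal_ofReal ht, smul_eq_mul]

lemma totalEnergy_add (hD : 0 < D) {μ ν : Measure ℂ} [SFinite μ] [SFinite ν]
    (hμ : Integrable φ μ) (hν : Integrable φ ν) (h1 : mutualEnergy D μ μ ≠ ⊤)
    (h2 : mutualEnergy D ν ν ≠ ⊤) (h3 : mutualEnergy D μ ν ≠ ⊤) :
    totalEnergy D φ (μ + ν) =
      totalEnergy D φ μ + totalEnergy D φ ν + 2 * (mutualEnergy D μ ν).toReal := by
  have h4 : 2 * mutualEnergy D μ ν ≠ ⊤ := ENNReal.mul_ne_top (by simp) h3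
  rw [totalEnergy, mutualEnergy_add_self hD, integral_add_measure hμ hν,
    ENNReal.toReal_add (ENNReal.add_ne_top.2 ⟨h1, h2⟩) h4, ENNReal.toReal_add h1 h2,
    ENNReal.toReal_mul, totalEnergy, totalEnergy]
  simp only [toReal_ofNat]
  ring

/-- A lower bound of the total energy over probability measures yields one over all positive
measures of mass at most one: the missing mass is filled up with a measure of bounded potential. -/
lemma exists_lower_bound (hD : 0 < D) {σ : Measure ℂ} [IsProbabilityMeasure σ]
    (hσK : σ Kᶜ = 0) (hσφ : Integrable φ σ) {B : ℝ≥0∞} (hB : B ≠ ⊤)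
    (hσB : ∀ z, ∫⁻ w, kern D z w ∂σ ≤ B) {m : ℝ}
    (hm : ∀ μ, IsProbabilityMeasure μ → IsTestMeasure D K φ μ → m ≤ totalEnergy D φ μ) :
    ∃ M : ℝ, ∀ τ, IsTestMeasure D K φ τ → -M ≤ totalEnergy D φ τ := by
  -- The added part c • σ costs at most B for its own energy, 2B for its interaction with τ and 2|∫φ
  -- dσ| for the field.
  refine ⟨-(m - 3 * B.toReal - 2 * |∫ x, φ x ∂σ|), fun τ hτ => ?_⟩
  have := hτ.isFiniteMeasure
  set c : ℝ≥0∞ := 1 - τ univ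
  have hc1 : c ≤ 1 := tsub_le_self
  have hc : c ≠ ⊤ := ne_top_of_le_ne_top one_ne_top hc1
  have hσσ : mutualEnergy D σ σ ≤ B := by simpa using mutualEnergy_le_of_potential_le (μ := σ) hσB
  have hτσ : mutualEnergy D τ σ ≤ B := by
    refine (mutualEnergy_le_of_potential_le hσB).trans ?_
    calc B * τ univ ≤ B * 1 := by gcongr; exact hτ.mass_le
      _ = B := mul_one B
  have hcσ : mutualEnergy D (c • σ) (c • σ) ≤ B := by
    rw [mutualEnergy_smul_smul hD]
    calc c ^ 2 * mutualEnergy D σ σ ≤ 1 ^ 2 * B := by gcongr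
      _ = B := by simp
  have hcτ : mutualEnergy D τ (c • σ) ≤ B := by
    rw [mutualEnergy_smul_right hD]
    calc c * mutualEnergy D τ σ ≤ 1 * B := by gcongr
      _ = B := one_mul B
  have : IsFiniteMeasure (c • σ) := Measure.smul_finite σ hc
  have hne1 := ne_top_of_le_ne_top hB hcσ
  have hne2 := ne_top_of_le_ne_top hB hcτ
  have hprob : IsProbabilityMeasure (τ + c • σ) := ⟨by
    simp only [Measure.add_apply, Measure.smul_apply, measure_univ, smul_eq_mul, mul_one]
    exact add_tsub_cancel_of_le hτ.mass_le⟩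
  have htest : IsTestMeasure D K φ (τ + c • σ) := by
    refine ⟨prob_le_one, ?_, ?_, hτ.integrable.add_measure (hσφ.smul_measure hc)⟩
    · simp [hτ.compl_eq_zero, hσK]
    · rw [mutualEnergy_add_self hD]
      exact ENNReal.add_ne_top.2 ⟨ENNReal.add_ne_top.2 ⟨hτ.energy_ne_top, hne1⟩,
        ENNReal.mul_ne_top (by simp) hne2⟩
  have h := hm _ hprob htest
  rw [totalEnergy_add hD hτ.integrable (hσφ.smul_measure hc) hτ.energy_ne_top hne1 hne2] at h
  have e1 := ENNReal.toReal_mono hB hcσ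
  have e2 := ENNReal.toReal_mono hB hcτ
  have e3 : ∫ x, φ x ∂(c • σ) ≤ |∫ x, φ x ∂σ| := by
    rw [integral_smul_measure, smul_eq_mul]
    refine (le_abs_self _).trans ?_
    rw [abs_mul, abs_of_nonneg ENNReal.toReal_nonneg]
    refine mul_le_of_le_one_left (abs_nonneg _) ?_
    simpa using ENNReal.toReal_mono one_ne_top hc1
  have e4 : totalEnergy D φ (c • σ) ≤ B.toReal + 2 * |∫ x, φ x ∂σ| := by
    rw [totalEnergy]
    linarith
  linarith

/-! ### Control of the field near the exceptional points -/

lemma mutualEnergy_restrict_le (μ : Measure ℂ) (S : Set ℂ) :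
    mutualEnergy D (μ.restrict S) (μ.restrict S) ≤ mutualEnergy D μ μ :=
  mutualEnergy_mono D Measure.restrict_le_self Measure.restrict_le_self

lemma measure_finite_eq_zero_of_mutualEnergy_ne_top (hD : 0 < D) {μ : Measure ℂ}
    (h : mutualEnergy D μ μ ≠ ⊤) {e : Set ℂ} (he : e.Finite) : μ e = 0 := by
  rw [← biUnion_of_singleton e]
  exact (measure_biUnion_null_iff he.countable).2 fun p _ =>
    measure_singleton_eq_zero_of_mutualEnergy_ne_top hD h p

/-- Finite energy makes e a null set, so removing small neighborhoods of e hardly changes the field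
term, while it can only decrease the energy. The gap obtained leaves room for further masses closer
to e. -/
lemma IsTestMeasure.exists_restrict_totalEnergy_lt {e : Set ℂ} (hD : 0 < D) (he : e.Finite)
    {τ : Measure ℂ} (hτ : IsTestMeasure D K φ τ) {c : ℝ} (hc : totalEnergy D φ τ < c) :
    ∃ ρ > 0, totalEnergy D φ (τ.restrict (Metric.thickening ρ e)ᶜ) < c := by
  set s : ℕ → Set ℂ := fun n => (Metric.thickening (1 / ((n : ℝ) + 1)) e)ᶜ
  have hs : Monotone s := fun n k hnk =>
    compl_subset_compl.2 (Metric.thickening_mono (one_div_le_one_div_of_le (by positivity)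
      (by gcongr)) e)
  have hunion : ⋃ n, s n = eᶜ := by
    simp only [s]
    rw [← compl_iInter]
    congr 1
    rw [← he.isClosed.closure_eq]
    refine subset_antisymm (fun z hz => ?_) (subset_iInter fun n => ?_)
    · rw [he.isClosed.closure_eq, mem_iInter] at hz
      rw [Metric.mem_closure_iff]
      intro ε hε
      obtain ⟨n, hn⟩ := exists_nat_one_div_lt hε
      obtain ⟨p, hp, hzp⟩ := Metric.mem_thickening_iff.1 (hz n)
      exact ⟨p, hp, hzp.trans hn⟩
    · rw [he.isClosed.closure_eq]
      exact Metric.self_subset_thickening (by positivity) e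
  have he0 : τ e = 0 := measure_finite_eq_zero_of_mutualEnergy_ne_top hD hτ.energy_ne_top he
  have hlim : Tendsto (fun n => ∫ x in s n, φ x ∂τ) atTop (𝓝 (∫ x, φ x ∂τ)) := by
    have h := tendsto_setIntegral_of_monotone (μ := τ) (f := φ) (s := s)
      (fun n => Metric.isOpen_thickening.measurableSet.compl) hs hτ.integrable.integrableOn
    rw [hunion, setIntegral_congr_set (t := univ), setIntegral_univ] at h
    · exact h
    · rw [ae_eq_univ, compl_compl]
      exact he0
  have hlim2 : Tendsto (fun n => (mutualEnergy D τ τ).toReal + 2 * ∫ x in s n, φ x ∂τ) atTop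
      (𝓝 (totalEnergy D φ τ)) := tendsto_const_nhds.add (hlim.const_mul 2)
  obtain ⟨n, hn⟩ := (hlim2.eventually (gt_mem_nhds hc)).exists
  refine ⟨1 / ((n : ℝ) + 1), by positivity, lt_of_le_of_lt ?_ hn⟩
  rw [totalEnergy]
  gcongr
  · exact hτ.energy_ne_top
  · exact mutualEnergy_restrict_le _ _

/-- Small masses near a finite set cannot have very negative total energy, as otherwise the sum of
many such masses, placed at very different distances to the set, would violate the lower bound. -/
lemma exists_thickening_le_totalEnergy {e : Set ℂ} (hD : 0 < D) (he : e.Finite) {M : ℝ}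
    (hM : ∀ τ, IsTestMeasure D K φ τ → -M ≤ totalEnergy D φ τ) {c : ℝ} (hc : 0 < c) :
    ∃ r > 0, ∀ τ, IsTestMeasure D K φ τ → τ (Metric.thickening r e)ᶜ = 0 →
      τ univ ≤ ENNReal.ofReal r → -c ≤ totalEnergy D φ τ := by
  by_contra! hcon
  have hann : ∀ r > 0, ∃ τ, ∃ ρ > 0, IsTestMeasure D K φ τ ∧ τ (Metric.thickening r e)ᶜ = 0 ∧
      τ univ ≤ ENNReal.ofReal r ∧ τ (Metric.thickening ρ e) = 0 ∧ totalEnergy D φ τ < -c := by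
    intro r hr
    obtain ⟨τ, hτ, hτr, hτm, hτc⟩ := hcon r hr
    obtain ⟨ρ, hρ, hlt⟩ := hτ.exists_restrict_totalEnergy_lt hD he hτc
    refine ⟨_, ρ, hρ, hτ.mono Measure.restrict_le_self, ?_, ?_, ?_, hlt⟩
    · exact le_zero_iff.1 ((Measure.restrict_le_self _).trans hτr.le)
    · exact (Measure.restrict_le_self _).trans hτm
    · rw [Measure.restrict_apply Metric.isOpen_thickening.measurableSet, inter_compl_self,
        measure_empty]
  -- Each new mass contributes less than -c, and its interaction of at most c/4 counts twice, so
  -- every step gains at least c/2.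
  have hsum : ∀ N : ℕ, ∀ r > 0, r ≤ 1 → ∃ τ, ∃ ρ > 0, IsTestMeasure D K φ τ ∧
      τ univ ≤ ENNReal.ofReal r ∧ τ (Metric.thickening ρ e) = 0 ∧
      totalEnergy D φ τ ≤ -(N * (c / 2)) := by
    intro N
    induction N with
    | zero =>
      intro r hr hr1
      exact ⟨0, 1, one_pos, isTestMeasure_zero, by simp, by simp,
        by simp [totalEnergy, mutualEnergy_zero_left]⟩
    | succ N ih =>
      intro r hr hr1
      obtain ⟨τ, ρ, hρ, hτ, hτm, hτρ, hτc⟩ := ih (r / 2) (by linarith) (by linarith)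
      set Q := |Real.log (D / (ρ / 2))|
      have hQ : 0 ≤ Q := abs_nonneg _
      -- The three bounds serve the total mass r, the distance ρ/2 from the earlier masses, and the
      -- interaction, which is at most Q · c/(4(Q + 1)) ≤ c/4.
      set r' := min (r / 2) (min (ρ / 2) (c / (4 * (Q + 1))))
      have hr' : 0 < r' := by positivity
      obtain ⟨τ₁, ρ₁, hρ₁, hτ₁, hτ₁r, hτ₁m, hτ₁ρ, hτ₁c⟩ := hann r' hr'
      have := hτ.isFiniteMeasure
      have := hτ₁.isFiniteMeasure
      have hcross : mutualEnergy D τ τ₁ ≤ ENNReal.ofReal (c / 4) := by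
        refine (mutualEnergy_le_of_separated hD (half_pos hρ) (S := (Metric.thickening ρ e)ᶜ)
          (by rwa [compl_compl]) hτ₁r fun z hz w hw => ?_).trans ?_
        · obtain ⟨p, hp, hwp⟩ := Metric.mem_thickening_iff.1 hw
          have hzp : ρ ≤ dist z p := by
            by_contra! hlt
            exact hz (Metric.mem_thickening_iff.2 ⟨p, hp, hlt⟩)
          have h1 : r' ≤ ρ / 2 := (min_le_right _ _).trans (min_le_left _ _)
          have := dist_triangle z w p
          rw [← dist_eq_norm]
          linarith
        · calc _ ≤ ENNReal.ofReal Q * ENNReal.ofReal (c / (4 * (Q + 1))) * 1 := by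
                gcongr
                · exact le_abs_self _
                · exact hτ₁m.trans (ENNReal.ofReal_le_ofReal
                    ((min_le_right _ _).trans (min_le_right _ _)))
                · exact hτ.mass_le
            _ = ENNReal.ofReal (Q * (c / (4 * (Q + 1)))) := by
                rw [mul_one, ENNReal.ofReal_mul hQ]
            _ ≤ ENNReal.ofReal (c / 4) := by
                refine ENNReal.ofReal_le_ofReal ?_
                rw [mul_div_assoc', div_le_div_iff₀ (by positivity) (by positivity)]
                nlinarith
      have hcross' : mutualEnergy D τ τ₁ ≠ ⊤ := ne_top_of_le_ne_top ENNReal.ofReal_ne_top hcross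
      have hmass : (τ + τ₁) univ ≤ ENNReal.ofReal r := by
        rw [Measure.add_apply]
        calc τ univ + τ₁ univ ≤ ENNReal.ofReal (r / 2) + ENNReal.ofReal (r / 2) := by
              gcongr
              exact hτ₁m.trans (ENNReal.ofReal_le_ofReal (min_le_left _ _))
          _ = ENNReal.ofReal r := by
              rw [← ENNReal.ofReal_add (by positivity) (by positivity), add_halves]
      refine ⟨τ + τ₁, min ρ ρ₁, lt_min hρ hρ₁, ⟨?_, ?_, ?_, ?_⟩, hmass, ?_, ?_⟩
      · exact hmass.trans (ENNReal.ofReal_le_one.2 hr1)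
      · simp [hτ.compl_eq_zero, hτ₁.compl_eq_zero]
      · rw [mutualEnergy_add_self hD]
        exact ENNReal.add_ne_top.2 ⟨ENNReal.add_ne_top.2 ⟨hτ.energy_ne_top, hτ₁.energy_ne_top⟩,
          ENNReal.mul_ne_top (by simp) hcross'⟩
      · exact hτ.integrable.add_measure hτ₁.integrable
      · rw [Measure.add_apply, add_eq_zero]
        exact ⟨measure_mono_null (Metric.thickening_mono (min_le_left _ _) e) hτρ,
          measure_mono_null (Metric.thickening_mono (min_le_right _ _) e) hτ₁ρ⟩
      · rw [totalEnergy_add hD hτ.integrable hτ₁.integrable hτ.energy_ne_top hτ₁.energy_ne_top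
          hcross']
        have := ENNReal.toReal_mono ENNReal.ofReal_ne_top hcross
        rw [ENNReal.toReal_ofReal (by positivity)] at this
        push_cast
        linarith
  obtain ⟨N, hN⟩ := exists_nat_gt (M / (c / 2))
  obtain ⟨τ, -, -, hτ, -, -, hτc⟩ := hsum N 1 one_pos le_rfl
  have h1 := hM τ hτ
  rw [div_lt_iff₀ (by positivity)] at hN
  linarith

/-- Measures of bounded energy have uniformly small mass near a finite set. -/
lemma exists_measure_thickening_le {e : Set ℂ} (hD : 0 < D) (he : e.Finite) {C : ℝ} (hC : 0 ≤ C)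
    {η : ℝ} (hη : 0 < η) :
    ∃ r > 0, ∀ μ : Measure ℂ, mutualEnergy D μ μ ≤ ENNReal.ofReal C →
      μ (Metric.thickening r e) ≤ ENNReal.ofReal η := by
  set N : ℝ := he.toFinset.card + 1
  have hN : 0 < N := by positivity
  set η' := η / N
  have hη' : 0 < η' := by positivity
  -- With this Λ one has Λη'² > C. The radius below makes log(D/(2r)) equal to Λ, so a ball of mass
  -- above η' would have energy above C.
  set Λ := C / η' ^ 2 + 1
  have hΛ : 0 < Λ := by positivity
  refine ⟨D / 2 * Real.exp (-Λ), by positivity, fun μ hμ => ?_⟩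
  set r := D / 2 * Real.exp (-Λ)
  have hlog : Real.log (D / (2 * r)) = Λ := by
    have : D / (2 * r) = Real.exp Λ := by
      simp only [r, Real.exp_neg]
      field_simp
    rw [this, Real.log_exp]
  have hball : ∀ p, μ (Metric.ball p r) ≤ ENNReal.ofReal η' := by
    intro p
    by_contra! hlt
    have h1 := (log_mul_measure_ball_sq_le (r := r) hD μ p).trans hμ
    rw [hlog] at h1
    have h2 : ENNReal.ofReal (Λ * η' ^ 2) ≤ ENNReal.ofReal C := by
      rw [ENNReal.ofReal_mul hΛ.le, ENNReal.ofReal_pow hη'.le]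
      refine le_trans ?_ h1
      gcongr
    rw [ENNReal.ofReal_le_ofReal_iff hC] at h2
    have h3 : Λ * η' ^ 2 = C + η' ^ 2 := by
      simp only [Λ]
      field_simp
    nlinarith [pow_pos hη' 2]
  have hcover : Metric.thickening r e = ⋃ p ∈ he.toFinset, Metric.ball p r := by
    rw [Metric.thickening_eq_biUnion_ball]
    simp
  rw [hcover]
  calc μ (⋃ p ∈ he.toFinset, Metric.ball p r) ≤ ∑ p ∈ he.toFinset, μ (Metric.ball p r) :=
        measure_biUnion_finset_le _ _
    _ ≤ ∑ p ∈ he.toFinset, ENNReal.ofReal η' := Finset.sum_le_sum fun p _ => hball p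
    _ = ENNReal.ofReal (he.toFinset.card * η') := by
        rw [Finset.sum_const, nsmul_eq_mul, ENNReal.ofReal_mul (by positivity),
          ENNReal.ofReal_natCast]
    _ ≤ ENNReal.ofReal η := by
        refine ENNReal.ofReal_le_ofReal ?_
        have : N * η' = η := by simp only [η']; field_simp
        nlinarith

/-- The negative part of the field is uniformly integrable near a finite set over measures of
bounded energy. -/
lemma exists_thickening_setIntegral_neg_ge {e : Set ℂ} (hD : 0 < D) (he : e.Finite)
    {M : ℝ} (hM : ∀ τ, IsTestMeasure D K φ τ → -M ≤ totalEnergy D φ τ) {C : ℝ} (hC : 0 ≤ C)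
    {δ : ℝ} (hδ : 0 < δ) :
    ∃ r > 0, ∀ μ, IsTestMeasure D K φ μ → mutualEnergy D μ μ ≤ ENNReal.ofReal C →
      ∀ S ⊆ Metric.thickening r e, MeasurableSet S → -δ ≤ ∫ x in S, φ x ∂μ := by
  -- Since tC ≤ δ, the energy of the scaled restriction is at most t²C ≤ tδ. A field integral below
  -- -δ would then push its total energy below tδ - 2tδ = -tδ, the threshold chosen for r₀.
  set t := min 1 (δ / (C + 1))
  have ht : 0 < t := by positivity
  obtain ⟨r₀, hr₀, h0⟩ := exists_thickening_le_totalEnergy hD he hM (mul_pos ht hδ)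
  obtain ⟨r₁, hr₁, h1⟩ := exists_measure_thickening_le hD he hC hr₀
  refine ⟨min r₀ r₁, lt_min hr₀ hr₁, fun μ hμ hμC S hS hSm => ?_⟩
  by_contra! hlt
  have := hμ.isFiniteMeasure
  have ht1 : ENNReal.ofReal t ≤ 1 := ENNReal.ofReal_le_one.2 (min_le_left _ _)
  have hle : ENNReal.ofReal t • μ.restrict S ≤ μ.restrict S := by
    intro A
    simp only [Measure.smul_apply, smul_eq_mul]
    exact mul_le_of_le_one_left zero_le ht1
  have htest := (hμ.mono (Measure.restrict_le_self (s := S))).mono hle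
  have hge := h0 _ htest ?_ ?_
  · rw [totalEnergy_smul hD ht.le] at hge
    have e1 : (mutualEnergy D (μ.restrict S) (μ.restrict S)).toReal ≤ C := by
      refine ENNReal.toReal_le_of_le_ofReal hC ((mutualEnergy_restrict_le μ S).trans hμC)
    have e2 : t * C ≤ δ := by
      have : t ≤ δ / (C + 1) := min_le_right _ _
      rw [le_div_iff₀ (by positivity)] at this
      nlinarith
    have e3 : t ^ 2 * (mutualEnergy D (μ.restrict S) (μ.restrict S)).toReal ≤ t * δ := by
      calc _ ≤ t ^ 2 * C := by gcongr
        _ = t * (t * C) := by ring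
        _ ≤ t * δ := by gcongr
    have e4 : t * ∫ x in S, φ x ∂μ < t * (-δ) := by gcongr
    linarith
  · refine le_zero_iff.1 ((hle _).trans ?_)
    rw [Measure.restrict_apply Metric.isOpen_thickening.measurableSet.compl]
    refine (measure_mono_null (t := ∅) ?_ measure_empty).le
    rintro x ⟨hx, hxS⟩
    exact hx (Metric.thickening_mono (min_le_left _ _) e (hS hxS))
  · refine (hle _).trans ?_
    rw [Measure.restrict_apply_univ]
    exact (measure_mono (hS.trans (Metric.thickening_mono (min_le_right _ _) e))).trans (h1 μ hμC)

/-- Halving μ quarters the energy but only halves the field term; comparing the lower bound for μ/2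
with the upper bound for μ isolates the energy. -/
lemma mutualEnergy_le_of_totalEnergy_le (hD : 0 < D) {M : ℝ}
    (hM : ∀ τ, IsTestMeasure D K φ τ → -M ≤ totalEnergy D φ τ) {m : ℝ} {μ : Measure ℂ}
    (hμ : IsTestMeasure D K φ μ) (hm : totalEnergy D φ μ ≤ m) :
    (mutualEnergy D μ μ).toReal ≤ 4 * M + 2 * m := by
  have := hμ.isFiniteMeasure
  have hle : ENNReal.ofReal (1 / 2) • μ ≤ μ := by
    intro A
    simp only [Measure.smul_apply, smul_eq_mul]
    exact mul_le_of_le_one_left zero_le (ENNReal.ofReal_le_one.2 (by norm_num))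
  have h := hM _ (hμ.mono hle)
  rw [totalEnergy_smul hD (by norm_num)] at h
  rw [totalEnergy] at hm
  linarith

/-- The lower bound for the restriction of μ to {φ < 0} controls the negative part of φ, and the
upper bound m controls the integral of φ. -/
lemma integral_abs_le_of_totalEnergy_le (hφ : Measurable φ) {M : ℝ}
    (hM : ∀ τ, IsTestMeasure D K φ τ → -M ≤ totalEnergy D φ τ) {m C : ℝ} {μ : Measure ℂ}
    (hμ : IsTestMeasure D K φ μ) (hm : totalEnergy D φ μ ≤ m)
    (hC : (mutualEnergy D μ μ).toReal ≤ C) :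
    ∫ x, |φ x| ∂μ ≤ m / 2 + (M + C) := by
  have hS : MeasurableSet {x | φ x < 0} := measurableSet_lt hφ measurable_const
  have h := hM _ (hμ.mono (Measure.restrict_le_self (s := {x | φ x < 0})))
  have h1 : (mutualEnergy D (μ.restrict {x | φ x < 0}) (μ.restrict {x | φ x < 0})).toReal ≤ C :=
    (ENNReal.toReal_mono hμ.energy_ne_top (mutualEnergy_restrict_le _ _)).trans hC
  have h2 : ∫ x, |φ x| ∂μ = ∫ x, φ x ∂μ - 2 * ∫ x in {x | φ x < 0}, φ x ∂μ := by
    rw [← integral_indicator hS, ← integral_const_mul,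
      ← integral_sub hμ.integrable ((hμ.integrable.indicator hS).const_mul 2)]
    refine integral_congr_ae (ae_of_all _ fun x => ?_)
    by_cases hx : φ x < 0
    · simp only [indicator_of_mem (s := {x | φ x < 0}) hx, abs_of_neg hx]
      ring
    · simp only [indicator_of_notMem (s := {x | φ x < 0}) hx, abs_of_nonneg (not_lt.1 hx)]
      ring
  have h3 : 0 ≤ (mutualEnergy D μ μ).toReal := ENNReal.toReal_nonneg
  rw [totalEnergy] at h hm
  linarith

/-! ### Cutoffs, weak limits and existence of a minimizer -/

/-- A continuous function that vanishes near `e` and is `1` away from `e`. -/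
def cutoff (e : Set ℂ) (r : ℝ) (z : ℂ) : ℝ := max 0 (min 1 (Metric.infDist z e / r - 1))

lemma continuous_cutoff (e : Set ℂ) (r : ℝ) : Continuous (cutoff e r) := by
  have := Metric.continuous_infDist_pt e
  unfold cutoff
  fun_prop

lemma cutoff_nonneg (e : Set ℂ) (r : ℝ) (z : ℂ) : 0 ≤ cutoff e r z := le_max_left _ _

lemma cutoff_le_one (e : Set ℂ) (r : ℝ) (z : ℂ) : cutoff e r z ≤ 1 :=
  max_le zero_le_one (min_le_left _ _)

lemma cutoff_eq_zero {e : Set ℂ} {r : ℝ} (hr : 0 < r) {z : ℂ} (h : Metric.infDist z e ≤ r) :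
    cutoff e r z = 0 :=
  max_eq_left ((min_le_right _ _).trans (by rw [sub_nonpos, div_le_one hr]; exact h))

lemma cutoff_eq_one {e : Set ℂ} {r : ℝ} (hr : 0 < r) {z : ℂ} (h : 2 * r ≤ Metric.infDist z e) :
    cutoff e r z = 1 := by
  have : 1 ≤ Metric.infDist z e / r - 1 := by
    rw [le_sub_iff_add_le, le_div_iff₀ hr]
    linarith
  rw [cutoff, min_eq_left this, max_eq_right zero_le_one]

/-- Tietze extension of φ from the compact part of K at distance at least r from e; the cutoff
vanishes on the rest. This makes the cut-off field a test function for weak convergence. -/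
lemma exists_boundedContinuous_eq_mul_cutoff (hK : IsCompact K) {e : Set ℂ} (he : e.Nonempty)
    (hφ : ContinuousOn φ (K \ e)) {r : ℝ} (hr : 0 < r) :
    ∃ g : ℂ →ᵇ ℝ, ∀ z ∈ K, g z = φ z * cutoff e r z := by
  set L := K ∩ (Metric.thickening r e)ᶜ
  have hL : IsCompact L := hK.inter_right Metric.isOpen_thickening.isClosed_compl
  have hLφ : ContinuousOn φ L := hφ.mono fun z hz =>
    ⟨hz.1, fun hze => hz.2 (Metric.self_subset_thickening hr e hze)⟩
  have : CompactSpace L := isCompact_iff_compactSpace.1 hL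
  obtain ⟨g, -, hg⟩ := BoundedContinuousFunction.exists_norm_eq_domRestrict_eq_of_closed
    (BoundedContinuousFunction.mkOfCompact ⟨L.domRestrict φ, hLφ.domRestrict⟩) hL.isClosed
  let χ : ℂ →ᵇ ℝ := BoundedContinuousFunction.ofNormedAddCommGroup (cutoff e r)
    (continuous_cutoff e r) 1 fun z => by
      rw [Real.norm_eq_abs, abs_of_nonneg (cutoff_nonneg e r z)]
      exact cutoff_le_one e r z
  refine ⟨g * χ, fun z hz => ?_⟩
  rw [BoundedContinuousFunction.mul_apply]
  change g z * cutoff e r z = _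
  by_cases hzr : z ∈ Metric.thickening r e
  · rw [cutoff_eq_zero hr ((Metric.mem_thickening_iff_infDist_lt he).1 hzr).le, mul_zero, mul_zero]
  · have h1 := congrArg (fun h => h ⟨z, hz, hzr⟩) hg
    have h2 : g z = φ z := h1
    rw [h2]

lemma eventually_cutoff_eq_one {e : Set ℂ} (he : e.Finite) (hne : e.Nonempty) {r : ℕ → ℝ}
    (hr : ∀ n, 0 < r n) (hr0 : Tendsto r atTop (𝓝 0)) {z : ℂ} (hz : z ∉ e) :
    ∀ᶠ n in atTop, cutoff e (r n) z = 1 := by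
  have hpos : 0 < Metric.infDist z e / 2 :=
    half_pos ((he.isClosed.notMem_iff_infDist_pos hne).1 hz)
  filter_upwards [hr0.eventually (gt_mem_nhds hpos)] with n hn
  exact cutoff_eq_one (hr n) (by linarith)

/-- Probability measures on a compact set subconverge weakly. -/
lemma exists_tendsto_probabilityMeasure (hK : IsCompact K) (μ : ℕ → ProbabilityMeasure ℂ)
    (hμ : ∀ n, (μ n : Measure ℂ) Kᶜ = 0) :
    ∃ (lam : ProbabilityMeasure ℂ) (F : Filter ℕ), F.NeBot ∧ F ≤ atTop ∧
      Tendsto μ F (𝓝 lam) ∧ (lam : Measure ℂ) Kᶜ = 0 := by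
  set S : Set (ProbabilityMeasure ℂ) := {ν | (ν : Measure ℂ) Kᶜ = 0}
  have htight : IsTightMeasureSet {((ν : ProbabilityMeasure ℂ) : Measure ℂ) | ν ∈ S} := by
    rw [isTightMeasureSet_iff_exists_isCompact_measure_compl_le]
    intro ε hε
    refine ⟨K, hK, ?_⟩
    rintro _ ⟨ν, hν, rfl⟩
    exact hν.le.trans zero_le
  obtain ⟨lam, -, hlam⟩ := (isCompact_closure_of_isTightMeasureSet htight).ultrafilter_le_nhds
    ((hyperfilter ℕ).map μ) (by
      rw [le_principal_iff]
      exact mem_map.2 (univ_mem' fun n => subset_closure (hμ n)))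
  have hlim : Tendsto μ (hyperfilter ℕ) (𝓝 lam) := hlam
  refine ⟨lam, hyperfilter ℕ, inferInstance, Nat.hyperfilter_le_atTop, hlim, ?_⟩
  have h := ProbabilityMeasure.le_liminf_measure_open_of_tendsto hlim hK.isClosed.isOpen_compl
  simp only [hμ] at h
  exact le_zero_iff.1 (h.trans (by simp))

lemma exists_boundedContinuous_kern (hD : 0 < D) (N : ℕ) :
    ∃ k : ℂ × ℂ →ᵇ ℝ, ∀ p, k p = (min (kern D p.1 p.2) N).toReal := by
  refine ⟨BoundedContinuousFunction.ofNormedAddCommGroup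
    (fun p : ℂ × ℂ => (min (kern D p.1 p.2) N).toReal) ?_ N fun p => ?_, fun p => rfl⟩
  · refine ENNReal.continuousOn_toReal.comp_continuous
      ((continuous_kern hD).min continuous_const) fun p => ?_
    exact ne_top_of_le_ne_top (ENNReal.natCast_ne_top N) (min_le_right _ _)
  · rw [Real.norm_eq_abs, abs_of_nonneg ENNReal.toReal_nonneg]
    simpa using ENNReal.toReal_mono (ENNReal.natCast_ne_top N)
      (min_le_right (kern D p.1 p.2) (N : ℝ≥0∞))

lemma ofReal_integral_min_kern (hD : 0 < D) (N : ℕ) (μ : Measure ℂ) [IsFiniteMeasure μ] :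
    ENNReal.ofReal (∫ p, (min (kern D p.1 p.2) N).toReal ∂(μ.prod μ)) =
      ∫⁻ p, min (kern D p.1 p.2) N ∂(μ.prod μ) := by
  have hlt : ∀ p : ℂ × ℂ, min (kern D p.1 p.2) N < ⊤ := fun p =>
    (min_le_right _ _).trans_lt (ENNReal.natCast_lt_top N)
  rw [integral_toReal ((measurable_kern hD).min measurable_const).aemeasurable
    (ae_of_all _ hlt), ENNReal.ofReal_toReal]
  refine ne_top_of_le_ne_top (b := ∫⁻ _, (N : ℝ≥0∞) ∂(μ.prod μ)) ?_
    (lintegral_mono fun p => min_le_right _ _)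
  rw [lintegral_const]
  exact ENNReal.mul_ne_top (ENNReal.natCast_ne_top N) (measure_ne_top _ _)

lemma integral_min_kern_le (hD : 0 < D) (N : ℕ) {μ : Measure ℂ} [IsFiniteMeasure μ]
    (hμ : mutualEnergy D μ μ ≠ ⊤) :
    ∫ p, (min (kern D p.1 p.2) N).toReal ∂(μ.prod μ) ≤ (mutualEnergy D μ μ).toReal := by
  rw [← ENNReal.ofReal_le_iff_le_toReal hμ, ofReal_integral_min_kern hD,
    mutualEnergy_eq_lintegral_prod hD]
  exact lintegral_mono fun p => min_le_left _ _

/-- Monotone convergence in the truncation level. As the truncated kernels are bounded and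
continuous, this yields lower semicontinuity of the energy under weak limits. -/
lemma mutualEnergy_le_of_integral_min_kern_le (hD : 0 < D) {μ : Measure ℂ} [IsFiniteMeasure μ]
    {X : ℝ} (h : ∀ N : ℕ, ∫ p, (min (kern D p.1 p.2) N).toReal ∂(μ.prod μ) ≤ X) :
    mutualEnergy D μ μ ≤ ENNReal.ofReal X := by
  have hsup : ∀ x : ℝ≥0∞, ⨆ N : ℕ, min x (N : ℝ≥0∞) = x := by
    intro x
    rw [← inf_iSup_eq, ENNReal.iSup_natCast, inf_top_eq]
  have : mutualEnergy D μ μ = ⨆ N : ℕ, ∫⁻ p, min (kern D p.1 p.2) N ∂(μ.prod μ) := by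
    rw [mutualEnergy_eq_lintegral_prod hD, ← lintegral_iSup
      (fun N => (measurable_kern hD).min measurable_const)]
    · exact lintegral_congr fun p => (hsup _).symm
    · intro N N' hN p
      simp only
      gcongr
  rw [this]
  refine iSup_le fun N => ?_
  rw [← ofReal_integral_min_kern hD]
  exact ENNReal.ofReal_le_ofReal (h N)

lemma ae_mem_of_compl_eq_zero {μ : Measure ℂ} (h : μ Kᶜ = 0) : ∀ᵐ z ∂μ, z ∈ K :=
  (measure_eq_zero_iff_ae_notMem.1 h).mono fun _ hz => not_not.1 hz

/-- Cutting off a field near `e` changes its integral by at most its negative part near `e`. -/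
lemma integral_mul_cutoff_le {e : Set ℂ} (hne : e.Nonempty) (hφ : Measurable φ)
    {μ : Measure ℂ} (hint : Integrable φ μ) {r r₀ δ : ℝ} (hr : 0 < r) (hr₀ : 2 * r ≤ r₀)
    (hδ : ∀ S ⊆ Metric.thickening r₀ e, MeasurableSet S → -δ ≤ ∫ x in S, φ x ∂μ) :
    ∫ x, φ x * cutoff e r x ∂μ ≤ ∫ x, φ x ∂μ + δ := by
  -- Multiplication by the cutoff can increase φ only where φ is negative and the cutoff is below 1,
  -- and such points lie in S.
  set S := {x | φ x < 0} ∩ Metric.thickening r₀ e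
  have hS : MeasurableSet S :=
    (measurableSet_lt hφ measurable_const).inter Metric.isOpen_thickening.measurableSet
  have h1 := hδ S inter_subset_right hS
  rw [← integral_indicator hS] at h1
  have hint2 : Integrable (fun x => φ x * cutoff e r x) μ := by
    refine hint.mono (hφ.mul (continuous_cutoff e r).measurable).aestronglyMeasurable
      (ae_of_all _ fun x => ?_)
    rw [norm_mul, Real.norm_eq_abs (cutoff e r x), abs_of_nonneg (cutoff_nonneg e r x)]
    exact mul_le_of_le_one_right (norm_nonneg _) (cutoff_le_one e r x)
  have h2 : ∫ x, φ x * cutoff e r x ∂μ + ∫ x, S.indicator φ x ∂μ ≤ ∫ x, φ x ∂μ := by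
    rw [← integral_add hint2 (hint.indicator hS)]
    refine integral_mono (hint2.add (hint.indicator hS)) hint fun x => ?_
    simp only
    by_cases hx : φ x < 0
    · by_cases hxr : x ∈ Metric.thickening r₀ e
      · rw [indicator_of_mem (show x ∈ S from ⟨hx, hxr⟩)]
        nlinarith [cutoff_nonneg e r x]
      · rw [indicator_of_notMem (fun h => hxr h.2), cutoff_eq_one hr, mul_one, add_zero]
        rw [Metric.mem_thickening_iff_infDist_lt hne, not_lt] at hxr
        linarith
    · rw [indicator_of_notMem (fun h => hx h.1), add_zero]
      exact mul_le_of_le_one_right (not_lt.1 hx) (cutoff_le_one e r x)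
  linarith

/-- Existence of a minimizer of the total energy. -/
lemma exists_totalEnergy_le (hD : 0 < D) (hK : IsCompact K) {e : Set ℂ} (he : e.Finite)
    (hne : e.Nonempty) (hφ : Measurable φ) (hφc : ContinuousOn φ (K \ e)) {M : ℝ}
    (hM : ∀ τ, IsTestMeasure D K φ τ → -M ≤ totalEnergy D φ τ) {m : ℝ}
    (hm : ∀ ε > 0, ∃ μ, IsProbabilityMeasure μ ∧ IsTestMeasure D K φ μ ∧
      totalEnergy D φ μ < m + ε) :
    ∃ lam, IsProbabilityMeasure lam ∧ IsTestMeasure D K φ lam ∧ totalEnergy D φ lam ≤ m := by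
  choose μ hμp hμ hμm using fun n : ℕ => hm (1 / ((n : ℝ) + 1)) (by positivity)
  set μ' : ℕ → ProbabilityMeasure ℂ := fun n => ⟨μ n, hμp n⟩
  obtain ⟨lam, F, hF, hFle, hlim, hlamK⟩ :=
    exists_tendsto_probabilityMeasure hK μ' fun n => (hμ n).compl_eq_zero
  have hlimit : Tendsto (fun n : ℕ => m + 1 / ((n : ℝ) + 1)) F (𝓝 m) := by
    have := (tendsto_one_div_add_atTop_nhds_zero_nat (𝕜 := ℝ)).const_add m
    rw [add_zero] at this
    exact this.mono_left hFle
  have hμ1 : ∀ n, totalEnergy D φ (μ n) ≤ m + 1 := fun n => (hμm n).le.trans (by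
    gcongr
    rw [div_le_one (by positivity)]
    linarith [(Nat.cast_nonneg n : (0 : ℝ) ≤ n)])
  set C := 4 * M + 2 * (m + 1)
  have hμC : ∀ n, (mutualEnergy D (μ n) (μ n)).toReal ≤ C := fun n =>
    mutualEnergy_le_of_totalEnergy_le hD hM (hμ n) (hμ1 n)
  have hC : 0 ≤ C := ENNReal.toReal_nonneg.trans (hμC 0)
  have hμC' : ∀ n, mutualEnergy D (μ n) (μ n) ≤ ENNReal.ofReal C := fun n => by
    rw [← ENNReal.ofReal_toReal (hμ n).energy_ne_top]
    exact ENNReal.ofReal_le_ofReal (hμC n)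
  choose k hk using fun N : ℕ => exists_boundedContinuous_kern hD N
  have hklim : ∀ N : ℕ, Tendsto
      (fun n => ∫ p, (min (kern D p.1 p.2) N).toReal ∂((μ n).prod (μ n))) F
      (𝓝 (∫ p, (min (kern D p.1 p.2) N).toReal ∂((lam : Measure ℂ).prod lam))) := by
    intro N
    have h1 : Tendsto (fun n => (μ' n).prod (μ' n)) F (𝓝 (lam.prod lam)) :=
      (ProbabilityMeasure.continuous_prod.tendsto (lam, lam)).comp (hlim.prodMk_nhds hlim)
    have h2 := ProbabilityMeasure.tendsto_iff_forall_integral_tendsto.1 h1 (k N)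
    simp only [hk] at h2
    exact h2
  have hglim := ProbabilityMeasure.tendsto_iff_forall_integral_tendsto.1 hlim
  have hlamE : mutualEnergy D (lam : Measure ℂ) lam ≠ ⊤ := by
    refine ne_top_of_le_ne_top (ENNReal.ofReal_ne_top (r := C)) ?_
    refine mutualEnergy_le_of_integral_min_kern_le hD fun N => ?_
    exact le_of_tendsto (hklim N) (Eventually.of_forall fun n =>
      (integral_min_kern_le hD N (hμ n).energy_ne_top).trans (hμC n))
  have hlame : (lam : Measure ℂ) e = 0 :=
    measure_finite_eq_zero_of_mutualEnergy_ne_top hD hlamE he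
  have hlame' : ∀ᵐ z ∂(lam : Measure ℂ), z ∉ e := measure_eq_zero_iff_ae_notMem.1 hlame
  have haeK := ae_mem_of_compl_eq_zero hlamK
  have haeKn := fun n => ae_mem_of_compl_eq_zero (hμ n).compl_eq_zero
  have hcut : ∀ r : ℝ, Measurable fun z => φ z * cutoff e r z := fun r =>
    hφ.mul (continuous_cutoff e r).measurable
  have hr0 : ∀ s : ℝ, Tendsto (fun n : ℕ => s * (1 / ((n : ℝ) + 1))) atTop (𝓝 0) := by
    intro s
    simpa using (tendsto_one_div_add_atTop_nhds_zero_nat (𝕜 := ℝ)).const_mul s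
  -- integrability of the field with respect to the weak limit
  have hlamφ : Integrable φ (lam : Measure ℂ) := by
    set C' := (m + 1) / 2 + (M + C)
    have hbound : ∀ r > 0, ∫⁻ z, ‖φ z * cutoff e r z‖ₑ ∂(lam : Measure ℂ) ≤ ENNReal.ofReal C' := by
      intro r hr
      obtain ⟨g, hg⟩ := exists_boundedContinuous_eq_mul_cutoff hK hne hφc hr
      have h1 : ∫ z, |g| z ∂(lam : Measure ℂ) ≤ C' := by
        refine le_of_tendsto (hglim |g|) (Eventually.of_forall fun n => ?_)
        refine le_trans ?_ (integral_abs_le_of_totalEnergy_le hφ hM (hμ n) (hμ1 n) (hμC n))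
        refine integral_mono_ae (BoundedContinuousFunction.integrable _ _)
          (hμ n).integrable.abs ?_
        filter_upwards [haeKn n] with z hz
        change |g z| ≤ |φ z|
        rw [hg z hz, abs_mul, abs_of_nonneg (cutoff_nonneg e r z)]
        exact mul_le_of_le_one_right (abs_nonneg _) (cutoff_le_one e r z)
      calc ∫⁻ z, ‖φ z * cutoff e r z‖ₑ ∂(lam : Measure ℂ)
          = ∫⁻ z, ENNReal.ofReal (|g| z) ∂(lam : Measure ℂ) := by
            refine lintegral_congr_ae (haeK.mono fun z hz => ?_)
            change _ = ENNReal.ofReal |g z|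
            rw [hg z hz, ← Real.norm_eq_abs, ofReal_norm]
        _ = ENNReal.ofReal (∫ z, |g| z ∂(lam : Measure ℂ)) :=
            (ofReal_integral_eq_lintegral_ofReal (BoundedContinuousFunction.integrable _ _)
              (ae_of_all _ fun z => abs_nonneg (g z))).symm
        _ ≤ ENNReal.ofReal C' := ENNReal.ofReal_le_ofReal h1
    refine ⟨hφ.aestronglyMeasurable, ?_⟩
    refine lt_of_le_of_lt ?_ (ENNReal.ofReal_lt_top (r := C'))
    -- The cutoffs tend to 1 off e, a null set of the limit, so Fatou's lemma carries the bound,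
    -- uniform in r, over to φ.
    calc ∫⁻ z, ‖φ z‖ₑ ∂(lam : Measure ℂ)
        ≤ ∫⁻ z, liminf (fun n : ℕ => ‖φ z * cutoff e (1 * (1 / ((n : ℝ) + 1))) z‖ₑ) atTop
            ∂(lam : Measure ℂ) := by
          refine lintegral_mono_ae (hlame'.mono fun z hz => ?_)
          refine le_of_eq (Tendsto.liminf_eq ?_).symm
          refine tendsto_const_nhds.congr' ?_
          filter_upwards [eventually_cutoff_eq_one he hne (fun n => by positivity) (hr0 1) hz]
            with n hn
          rw [hn, mul_one]
      _ ≤ liminf (fun n : ℕ => ∫⁻ z, ‖φ z * cutoff e (1 * (1 / ((n : ℝ) + 1))) z‖ₑ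
            ∂(lam : Measure ℂ)) atTop := lintegral_liminf_le fun n => (hcut _).enorm
      _ ≤ liminf (fun _ : ℕ => ENNReal.ofReal C') atTop :=
          liminf_le_liminf (Eventually.of_forall fun n => hbound _ (by positivity))
      _ = ENNReal.ofReal C' := liminf_const _
  refine ⟨lam, inferInstance, ⟨prob_le_one, hlamK, hlamE, hlamφ⟩, ?_⟩
  refine le_of_forall_pos_le_add fun δ hδ => ?_
  obtain ⟨r₀, hr₀, hnc⟩ := exists_thickening_setIntegral_neg_ge hD he hM hC (half_pos hδ)
  -- For a fixed radius and truncation level both integrals converge along F. The loss δ/2 from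
  -- `integral_mul_cutoff_le` counts twice in the total energy.
  have hfix : ∀ r > 0, 2 * r ≤ r₀ →
      (mutualEnergy D (lam : Measure ℂ) lam).toReal +
        2 * ∫ z, φ z * cutoff e r z ∂(lam : Measure ℂ) ≤ m + δ := by
    intro r hr hr2
    obtain ⟨g, hg⟩ := exists_boundedContinuous_eq_mul_cutoff hK hne hφc hr
    have hlamg : ∫ z, φ z * cutoff e r z ∂(lam : Measure ℂ) = ∫ z, g z ∂(lam : Measure ℂ) :=
      integral_congr_ae (haeK.mono fun z hz => (hg z hz).symm)
    rw [hlamg, ← le_sub_iff_add_le]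
    have hN : ∀ N : ℕ, ∫ p, (min (kern D p.1 p.2) N).toReal ∂((lam : Measure ℂ).prod lam) ≤
        m + δ - 2 * ∫ z, g z ∂(lam : Measure ℂ) := by
      intro N
      rw [le_sub_iff_add_le]
      refine le_of_tendsto_of_tendsto ((hklim N).add ((hglim g).const_mul 2))
        (hlimit.add_const δ) (Eventually.of_forall fun n => ?_)
      have h1 := integral_min_kern_le hD N (hμ n).energy_ne_top
      have h2 : ∫ z, g z ∂(μ n) = ∫ z, φ z * cutoff e r z ∂(μ n) :=
        integral_congr_ae ((haeKn n).mono fun z hz => hg z hz)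
      have h3 := integral_mul_cutoff_le hne hφ (hμ n).integrable hr hr2
        (hnc (μ n) (hμ n) (hμC' n))
      have h4 := (hμm n).le
      rw [totalEnergy] at h4
      change _ + 2 * ∫ z, g z ∂(μ n) ≤ _
      rw [h2]
      linarith
    refine ENNReal.toReal_le_of_le_ofReal ?_ (mutualEnergy_le_of_integral_min_kern_le hD hN)
    exact (integral_nonneg fun p => ENNReal.toReal_nonneg).trans (hN 0)
  have hφlim : Tendsto (fun n : ℕ => ∫ z, φ z * cutoff e (r₀ / 2 * (1 / ((n : ℝ) + 1))) z
      ∂(lam : Measure ℂ)) atTop (𝓝 (∫ z, φ z ∂(lam : Measure ℂ))) := by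
    refine tendsto_integral_of_dominated_convergence (fun z => |φ z|)
      (fun n => (hcut _).aestronglyMeasurable) hlamφ.abs (fun n => ae_of_all _ fun z => ?_) ?_
    · rw [norm_mul, Real.norm_eq_abs, Real.norm_eq_abs, abs_of_nonneg (cutoff_nonneg e _ z)]
      exact mul_le_of_le_one_right (abs_nonneg _) (cutoff_le_one e _ z)
    · filter_upwards [hlame'] with z hz
      refine tendsto_const_nhds.congr' ?_
      filter_upwards [eventually_cutoff_eq_one he hne (fun n => by positivity) (hr0 (r₀ / 2)) hz]
        with n hn
      rw [hn, mul_one]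
  refine le_of_tendsto ((hφlim.const_mul 2).const_add _) (Eventually.of_forall fun n => ?_)
  refine hfix _ (by positivity) ?_
  have : 1 / ((n : ℝ) + 1) ≤ 1 := by
    rw [div_le_one (by positivity)]
    linarith [(Nat.cast_nonneg n : (0 : ℝ) ≤ n)]
  nlinarith

/-! ### Uniqueness and the return to the original energies -/

/-- Strict convexity of the total energy makes its minimizer unique. -/
lemma eq_of_totalEnergy_le (hD : 0 < D) (hKD : ∀ z ∈ K, ∀ w ∈ K, ‖z - w‖ ≤ D) {μ ν : Measure ℂ}
    [IsProbabilityMeasure μ] [IsProbabilityMeasure ν] (hμ : IsTestMeasure D K φ μ)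
    (hν : IsTestMeasure D K φ ν) {m : ℝ} (hμm : totalEnergy D φ μ ≤ m)
    (hνm : totalEnergy D φ ν ≤ m)
    (hm : ∀ ρ, IsProbabilityMeasure ρ → IsTestMeasure D K φ ρ → m ≤ totalEnergy D φ ρ) :
    μ = ν := by
  by_contra hne
  obtain ⟨d, hd, hle⟩ := exists_two_mul_mutualEnergy_add_le hD hKD hμ.compl_eq_zero
    hν.compl_eq_zero hμ.energy_ne_top hν.energy_ne_top hne
  have hfin : mutualEnergy D μ μ + mutualEnergy D ν ν ≠ ⊤ :=
    ENNReal.add_ne_top.2 ⟨hμ.energy_ne_top, hν.energy_ne_top⟩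
  have h2d := ne_top_of_le_ne_top hfin hle
  have h2 : 2 * mutualEnergy D μ ν ≠ ⊤ := (ENNReal.add_ne_top.1 h2d).1
  have hdt : d ≠ ⊤ := (ENNReal.add_ne_top.1 h2d).2
  have hμν : mutualEnergy D μ ν ≠ ⊤ := fun h => h2 (by rw [h]; simp)
  have hle' := ENNReal.toReal_mono hfin hle
  rw [ENNReal.toReal_add h2 hdt, ENNReal.toReal_add hμ.energy_ne_top hν.energy_ne_top,
    ENNReal.toReal_mul, toReal_ofNat] at hle'
  have hd' : 0 < d.toReal := ENNReal.toReal_pos hd.ne' hdt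
  -- At the midpoint the total energy is at most m - d/4, which contradicts minimality.
  set ρ := ENNReal.ofReal (1 / 2) • (μ + ν)
  have hmass : ρ univ = 1 := by
    simp only [ρ, Measure.smul_apply, Measure.add_apply, measure_univ, smul_eq_mul]
    rw [one_add_one_eq_two, show (2 : ℝ≥0∞) = ENNReal.ofReal 2 by simp,
      ← ENNReal.ofReal_mul (by norm_num)]
    norm_num
  have henergy : mutualEnergy D (μ + ν) (μ + ν) ≠ ⊤ := by
    rw [mutualEnergy_add_self hD]
    exact ENNReal.add_ne_top.2 ⟨hfin, h2⟩
  have hρ : IsTestMeasure D K φ ρ := by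
    refine ⟨hmass.le, ?_, ?_, (hμ.integrable.add_measure hν.integrable).smul_measure
      ENNReal.ofReal_ne_top⟩
    · simp [ρ, hμ.compl_eq_zero, hν.compl_eq_zero]
    · rw [mutualEnergy_smul_smul hD]
      exact ENNReal.mul_ne_top (by simp) henergy
  have h := hm ρ ⟨hmass⟩ hρ
  rw [totalEnergy_smul hD (by norm_num), mutualEnergy_add_self hD,
    integral_add_measure hμ.integrable hν.integrable, ENNReal.toReal_add hfin h2,
    ENNReal.toReal_add hμ.energy_ne_top hν.energy_ne_top, ENNReal.toReal_mul, toReal_ofNat] at h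
  rw [totalEnergy] at hμm hνm
  linarith

/-- Measures of finite energy on K do not see the values of φ on e or outside K, where φ need not be
regular. -/
lemma indicator_ae_eq_of_mutualEnergy_ne_top (hD : 0 < D) {e : Set ℂ} (he : e.Finite)
    {μ : Measure ℂ} (hμK : μ Kᶜ = 0) (hμ : mutualEnergy D μ μ ≠ ⊤) : (K \ e).indicator φ =ᵐ[μ] φ := by
  filter_upwards [ae_mem_of_compl_eq_zero hμK, measure_eq_zero_iff_ae_notMem.1
    (measure_finite_eq_zero_of_mutualEnergy_ne_top hD hμ he)] with z hz hze
  exact indicator_of_mem (s := K \ e) ⟨hz, hze⟩ φ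

lemma isTestMeasure_indicator_iff (hD : 0 < D) {e : Set ℂ} (he : e.Finite) {μ : Measure ℂ} :
    IsTestMeasure D K ((K \ e).indicator φ) μ ↔ IsTestMeasure D K φ μ :=
  ⟨fun h => ⟨h.1, h.2, h.3, h.4.congr (indicator_ae_eq_of_mutualEnergy_ne_top hD he h.2 h.3)⟩,
    fun h => ⟨h.1, h.2, h.3, h.4.congr (indicator_ae_eq_of_mutualEnergy_ne_top hD he h.2 h.3).symm⟩⟩

lemma totalEnergy_indicator (hD : 0 < D) {e : Set ℂ} (he : e.Finite) {μ : Measure ℂ}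
    (hμ : IsTestMeasure D K φ μ) :
    totalEnergy D ((K \ e).indicator φ) μ = totalEnergy D φ μ := by
  rw [totalEnergy, totalEnergy,
    integral_congr_ae (indicator_ae_eq_of_mutualEnergy_ne_top hD he hμ.compl_eq_zero
      hμ.energy_ne_top)]

lemma exists_unique_totalEnergy_minimizer (hD : 0 < D) (hK : IsAdmissibleCompact K)
    (hKD : ∀ z ∈ K, ∀ w ∈ K, ‖z - w‖ ≤ D) (hφ : IsExternalField K φ) {c : ℝ}
    (hc : ∀ μ, IsProbabilityMeasure μ → IsTestMeasure D K φ μ → c ≤ totalEnergy D φ μ) :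
    ∃ lam, IsProbabilityMeasure lam ∧ IsTestMeasure D K φ lam ∧
      (∀ μ, IsProbabilityMeasure μ → IsTestMeasure D K φ μ →
        totalEnergy D φ lam ≤ totalEnergy D φ μ) ∧
      ∀ μ, IsProbabilityMeasure μ → IsTestMeasure D K φ μ →
        totalEnergy D φ μ = totalEnergy D φ lam → μ = lam := by
  obtain ⟨e₀, he₀, hφe₀⟩ := hφ
  -- The exceptional set is made nonempty because `Metric.infDist` to the empty set is 0, which
  -- would make every cutoff vanish identically.
  set e := insert 0 e₀
  have he : e.Finite := he₀.insert 0
  have hφe : ContinuousOn φ (K \ e) := hφe₀.mono (sdiff_subset_sdiff_right (subset_insert 0 e₀))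
  have hmeasS : MeasurableSet (K \ e) := hK.isCompact.measurableSet.diff he.measurableSet
  set ψ := (K \ e).indicator φ
  have hψc : ContinuousOn ψ (K \ e) := hφe.congr fun z hz => indicator_of_mem hz φ
  have hψ : Measurable ψ := by
    classical
    rw [show ψ = (K \ e).piecewise φ (fun _ => 0) from (piecewise_eq_indicator ..).symm]
    exact hφe.measurable_piecewise continuousOn_const hmeasS
  have hiff : ∀ μ, IsTestMeasure D K ψ μ ↔ IsTestMeasure D K φ μ := fun μ =>
    isTestMeasure_indicator_iff hD he
  have heq : ∀ μ, IsTestMeasure D K φ μ → totalEnergy D ψ μ = totalEnergy D φ μ := fun μ hμ =>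
    totalEnergy_indicator hD he hμ
  have hcψ : ∀ μ, IsProbabilityMeasure μ → IsTestMeasure D K ψ μ → c ≤ totalEnergy D ψ μ :=
    fun μ hμp hμ => by
      rw [heq μ ((hiff μ).1 hμ)]
      exact hc μ hμp ((hiff μ).1 hμ)
  -- The measure σ lives on a compact set off e, where the field is continuous; it shows that the
  -- class is nonempty and supplies missing mass.
  obtain ⟨L, hLK, hL, σ, hσ, hσL, B, hB, hσB⟩ := hK.exists_measure hD he
  have hσK : σ Kᶜ = 0 := measure_mono_null (compl_subset_compl.2 (hLK.trans sdiff_subset)) hσL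
  have hσψ : Integrable ψ σ := by
    have h1 : IntegrableOn ψ L σ := (hψc.mono hLK).integrableOn_compact hL
    rwa [IntegrableOn, Measure.restrict_eq_self_of_ae_mem (ae_mem_of_compl_eq_zero hσL)] at h1
  have hσt : IsTestMeasure D K ψ σ := by
    refine ⟨prob_le_one, hσK, ne_top_of_le_ne_top hB ?_, hσψ⟩
    simpa using mutualEnergy_le_of_potential_le (μ := σ) hσB
  obtain ⟨M, hM⟩ := exists_lower_bound hD hσK hσψ hB hσB hcψ
  set T : Set ℝ := {x | ∃ μ, IsProbabilityMeasure μ ∧ IsTestMeasure D K ψ μ ∧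
    totalEnergy D ψ μ = x}
  have hTne : T.Nonempty := ⟨_, σ, hσ, hσt, rfl⟩
  have hTb : BddBelow T := ⟨c, by rintro _ ⟨μ, hμp, hμ, rfl⟩; exact hcψ μ hμp hμ⟩
  have hmin : ∀ μ, IsProbabilityMeasure μ → IsTestMeasure D K ψ μ →
      sInf T ≤ totalEnergy D ψ μ := fun μ hμp hμ => csInf_le hTb ⟨μ, hμp, hμ, rfl⟩
  obtain ⟨lam, hlamp, hlam, hlamm⟩ := exists_totalEnergy_le hD hK.isCompact he
    (insert_nonempty 0 e₀) hψ hψc hM (m := sInf T) fun ε hε => by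
      obtain ⟨_, ⟨μ, hμp, hμ, rfl⟩, hlt⟩ := exists_lt_of_csInf_lt hTne (lt_add_of_pos_right _ hε)
      exact ⟨μ, hμp, hμ, hlt⟩
  have hlamφ := (hiff lam).1 hlam
  refine ⟨lam, hlamp, hlamφ, fun μ hμp hμ => ?_, fun μ hμp hμ hμe => ?_⟩
  · rw [← heq lam hlamφ, ← heq μ hμ]
    exact hlamm.trans (hmin μ hμp ((hiff μ).2 hμ))
  · refine eq_of_totalEnergy_le hD hKD ((hiff μ).2 hμ) hlam ?_ hlamm hmin
    rw [heq μ hμ, hμe, ← heq lam hlamφ]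
    exact hlamm

lemma mem_admissibleMeasures_iff (hD : 1 ≤ D) (hK : IsCompact K)
    (hKD : ∀ z ∈ K, ∀ w ∈ K, ‖z - w‖ ≤ D) {μ : Measure ℂ} :
    μ ∈ admissibleMeasures K φ ↔ IsProbabilityMeasure μ ∧ IsTestMeasure D K φ μ := by
  constructor
  · rintro ⟨⟨-, -, hE⟩, hint, hmass, hsupp⟩
    have hp : IsProbabilityMeasure μ := ⟨hmass⟩
    have hμK : μ Kᶜ = 0 :=
      measure_mono_null (compl_subset_compl.2 hsupp) Measure.measure_compl_support
    refine ⟨hp, hmass.le, hμK, fun htop => ?_, hint⟩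
    rw [energy_eq_mutualEnergy_sub hD hKD hμK, htop] at hE
    exact absurd hE (by simp)
  · rintro ⟨hp, hμ⟩
    refine ⟨⟨inferInstance, ?_, ?_⟩, hμ.integrable, measure_univ, ?_⟩
    · obtain ⟨R, hR⟩ := hK.isBounded.exists_norm_le
      refine lt_of_le_of_lt (lintegral_mono_ae (g := fun _ => ENNReal.ofReal (Real.log (1 + R)))
        ((ae_mem_of_compl_eq_zero hμ.compl_eq_zero).mono fun z hz => ?_)) (by simp)
      have := hR z hz
      have := norm_nonneg z
      gcongr
    · rw [energy_eq_mutualEnergy_sub hD hKD hμ.compl_eq_zero]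
      rw [← ENNReal.ofReal_toReal hμ.energy_ne_top, EReal.coe_ennreal_ofReal, ← EReal.coe_sub]
      exact EReal.coe_lt_top _
    · exact Measure.support_subset_of_isClosed hK.isClosed
        (ae_mem_of_compl_eq_zero hμ.compl_eq_zero)

lemma weightedEnergy_eq_totalEnergy_sub (hD : 1 ≤ D) (hKD : ∀ z ∈ K, ∀ w ∈ K, ‖z - w‖ ≤ D)
    {μ : Measure ℂ} [IsProbabilityMeasure μ] (hμ : IsTestMeasure D K φ μ) :
    weightedEnergy φ μ = ((totalEnergy D φ μ - Real.log D : ℝ) : EReal) := by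
  rw [weightedEnergy, energy_eq_mutualEnergy_sub hD hKD hμ.compl_eq_zero,
    ← ENNReal.ofReal_toReal hμ.energy_ne_top, EReal.coe_ennreal_ofReal,
    max_eq_left ENNReal.toReal_nonneg, ← EReal.coe_sub, ← EReal.coe_add, totalEnergy]
  congr 1
  ring

end LogEnergy

end

theorem mainTheorem7 (K : Set ℂ) (hK : LogEnergy.IsAdmissibleCompact K) (φ : ℂ → ℝ)
    (hφ : LogEnergy.IsExternalField K φ) (hE : ⊥ < LogEnergy.equilibriumEnergy φ K) :
    ∃! lam : Measure ℂ, lam ∈ LogEnergy.admissibleMeasures K φ ∧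
      LogEnergy.weightedEnergy φ lam = LogEnergy.equilibriumEnergy φ K := by
  open LogEnergy in
  obtain ⟨R, hR⟩ := hK.isCompact.isBounded.exists_norm_le
  -- 2R bounds the distances in K, and 1 makes log D nonnegative.
  set D := max 1 (2 * R)
  have hD : 1 ≤ D := le_max_left _ _
  have hD0 : 0 < D := one_pos.trans_le hD
  have hKD : ∀ z ∈ K, ∀ w ∈ K, ‖z - w‖ ≤ D := fun z hz w hw =>
    (norm_sub_le z w).trans ((add_le_add (hR z hz) (hR w hw)).trans
      ((two_mul R).symm.le.trans (le_max_right _ _)))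
  have hmem := fun μ => mem_admissibleMeasures_iff (φ := φ) (μ := μ) hD hK.isCompact hKD
  obtain ⟨c, -, hc⟩ := EReal.lt_iff_exists_real_btwn.1 hE
  have hle : ∀ μ, μ ∈ admissibleMeasures K φ → equilibriumEnergy φ K ≤ weightedEnergy φ μ :=
    fun μ hμ => iInf₂_le μ hμ
  obtain ⟨lam, hlamp, hlam, hmin, huniq⟩ := exists_unique_totalEnergy_minimizer hD0 hK hKD hφ
    (c := c + Real.log D) fun μ hμp hμ => by
      have h := hc.le.trans (hle μ ((hmem μ).2 ⟨hμp, hμ⟩))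
      rw [weightedEnergy_eq_totalEnergy_sub hD hKD hμ, EReal.coe_le_coe_iff] at h
      linarith
  have hlamE : weightedEnergy φ lam = equilibriumEnergy φ K := by
    refine le_antisymm (le_iInf₂ fun μ hμ => ?_) (hle lam ((hmem lam).2 ⟨hlamp, hlam⟩))
    obtain ⟨hμp, hμt⟩ := (hmem μ).1 hμ
    rw [weightedEnergy_eq_totalEnergy_sub hD hKD hlam, weightedEnergy_eq_totalEnergy_sub hD hKD hμt,
      EReal.coe_le_coe_iff]
    linarith [hmin μ hμp hμt]
  refine ⟨lam, ⟨(hmem lam).2 ⟨hlamp, hlam⟩, hlamE⟩, ?_⟩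
  rintro μ ⟨hμ, hμE⟩
  obtain ⟨hμp, hμt⟩ := (hmem μ).1 hμ
  refine huniq μ hμp hμt ?_
  rw [← hlamE, weightedEnergy_eq_totalEnergy_sub hD hKD hlam,
    weightedEnergy_eq_totalEnergy_sub hD hKD hμt, EReal.coe_eq_coe_iff] at hμE
  linarith
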